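/- Let $k_1,\dots,k_L$ be loop momenta, $p_1,\dots,p_E\in\mathbb R^{1,n}$ external momenta (real Minkowski vectors, metric $(+,-,\dots,-)$, $n$ arbitrary), $m_1,\dots,m_P\in\mathbb R$ masses, $q_j=\sum_l a_{jl}k_l+\sum_e b_{je}p_e$ with real coefficients $a_{jl},b_{je}$, $\nu\in\mathbb Z^P$, $\varepsilon>0$, and let $$F_I=\frac{\mathcal N(\{k_l\cdot k_{l'}\},\{k_l\cdot p_e\};D)}{\prod_{j=1}^P(m_j^2-q_j^2-i\varepsilon)^{\nu_j}},$$ where $\mathcal N$ is a polynomial in the indicated products whose coefficients may depend on $D$. Let $S\subseteq\{1,\dots,L\}$ and $i\in S$. The momenta $k_l$ with $l\in S$ are integrated over and those with $l\notin S$ are held fixed in $\mathbb R^{1,n}$; $S=\{i\}$ gives the integral over the single momentum $k_i$, and $S=\{1,\dots,L\}$ the integral over all loop momenta. Then, in dimensional regularisation, $$\int\prod_{l\in S}\mathrm d^Dk_l\;\frac{\partial}{\partial k_i^\mu}\bigl[v^\mu F_I\bigr]=0$$ as a meromorphic function of $D\in\mathbb C$, for every $D$-dimensional vector $v=\sum_{l\in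 S}c_l k_l+w$, $w\in\mathbb R^{1,n}\otimes\mathbb C$, where the coefficients $c_l$ and the components of $w$ are constants or, more generally, polynomials with complex coefficients in the $k_l\cdot k_{l'}$ and the components of the $k_l$ along $\mathbb R^{1,n}$ ($l,l'\in S$). (In particular $v$ may be any vector independent of $k_i$, or $v=k_i$.) This holds for every $\varepsilon>0$, hence also in the limit $\varepsilon\to0^+$. Here the derivative is expanded by the product and chain rules with $\partial k_l^\mu/\partial k_i^\mu=D\,\delta_{il}$, which gives a finite sum of terms $N/\prod_jX_j^{\nu_j}$, where $X_j=m_j^2-q_j^2-i\varepsilon$ and $N$ is a polynomial in the $k_l\cdot k_{l'}$ and the components of the $k_l$ along $\mathbb R^{1,n}$. The dimensionally regularised integral of such a sum is the meromorphic function of $D\in\mathbb C$ (with removable singularities removed) that for all sufficiently negative $\operatorname{Re}D$ equals the sum over the terms of the absolutely convergent Schwinger parametric integrals $$\prod_{\nu_j>0}\frac{i^{\nu_j}}{\Gamma(\nu_j)}\int_0^\infty\mathrm d\alpha_j\,\alpha_j^{\nu_j-1}\;\int\prod_{l\in S}\mathrm d^Dk_l\;\Bigl(N\prod_{\nu_j\le0}X_j^{-\nu_j}\Bigr)e^{-i\sum_{\nu_j>0}\alpha_jX_j};$$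 the assertion includes that these integrals converge. The inner $D$-dimensional Gaussian integral of a polynomial $f$ is as follows. Put $A_{ll'}=\sum_{\nu_j>0}\alpha_ja_{jl}a_{jl'}$ for $l,l'\in S$, let $r_j$ be the part of $q_j$ that does not contain the integrated momenta, and put $b_l=\sum_{\nu_j>0}\alpha_ja_{jl}r_j$ and $\kappa=-A^{-1}b$. The integral is $$\bigl(i\pi^{D/2}e^{-i\pi D/4}\bigr)^{|S|}(\det A)^{-D/2}\,e^{-i\sum_{\nu_j>0}\alpha_j(m_j^2-r_j^2-i\varepsilon)-i\sum_{l,l'}(A^{-1})_{ll'}\,b_l\cdot b_{l'}}\Bigl[e^{\frac i4\sum_{l,l'}(A^{-1})_{ll'}\,\partial_{k_l}\cdot\,\partial_{k_{l'}}}f\Bigr]_{k=\kappa},$$ and it is $0$ if $\det A=0$. -/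

import Mathlib

noncomputable section

namespace DimReg

/-- The diagonal entries `(1, -1, …, -1)` of the Minkowski metric on `ℝ^{1,n}`. -/
def metric {n : ℕ} (μ : Fin (n + 1)) : ℝ := if μ = 0 then 1 else -1

/-- Vectors of `ℝ^{1,n}`. All the momenta that are held fixed (and all the fixed auxiliary
vectors) span a finite-dimensional space, which is contained in `ℝ^{1,n}` for some `n`. -/
abbrev Mink (n : ℕ) : Type := Fin (n + 1) → ℝ

/-- The Minkowski product. -/
def mdot {n : ℕ} (x y : Mink n) : ℝ := ∑ μ, metric μ * x μ * y μ

theorem mdot_comm {n : ℕ} (x y : Mink n) : mdot x y = mdot y x :=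
  Finset.sum_congr rfl fun μ _ => by ring

/-! ### Vector calculus in `D` dimensions

`ι` indexes the momenta that are integrated over. Their `D`-dimensional space is thought of as
`ℝ^{1,n}` plus an orthogonal complement of dimension `D - n - 1`. -/

/-- The scalars on which an integrand may depend: the products `k_l · k_{l'}` and the
components `k_l^μ` along `ℝ^{1,n}` (hence all `k_l · w` with `w` in `ℝ^{1,n}`). -/
abbrev ScalarVar (ι : Type) (n : ℕ) : Type := Sym2 ι ⊕ ι × Fin (n + 1)

/-- Polynomial scalar functions of the integrated momenta. -/
abbrev Scalar (ι : Type) (n : ℕ) : Type := MvPolynomial (ScalarVar ι n) ℂ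

/-- A `D`-dimensional vector `v = ∑_l loop_l k_l + ∑_μ par_μ e_μ`; its coefficients may depend
polynomially on the integrated momenta. -/
structure Vec (ι : Type) (n : ℕ) where
  /-- coefficients of the integrated momenta -/
  loop : ι → Scalar ι n
  /-- coefficients of the standard basis of `ℝ^{1,n}` -/
  par : Fin (n + 1) → Scalar ι n

section Calculus

variable {ι : Type} [Fintype ι] {n : ℕ}

/-- A fixed vector of `ℝ^{1,n}`. -/
def constVec (x : Mink n) : Vec ι n := ⟨0, fun μ => MvPolynomial.C (x μ : ℂ)⟩

/-- The product `v · w`. -/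
def dot (v w : Vec ι n) : Scalar ι n :=
  (∑ l, ∑ l', v.loop l * w.loop l' * MvPolynomial.X (Sum.inl s(l, l')))
    + (∑ l, ∑ μ, MvPolynomial.C (metric μ : ℂ) *
        (v.loop l * w.par μ + w.loop l * v.par μ) * MvPolynomial.X (Sum.inr (l, μ)))
    + ∑ μ, MvPolynomial.C (metric μ : ℂ) * v.par μ * w.par μ

theorem dot_comm (v w : Vec ι n) : dot v w = dot w v := by
  have h1 : (∑ l, ∑ l', v.loop l * w.loop l' * (MvPolynomial.X (Sum.inl s(l, l')) : Scalar ι n))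
      = ∑ l, ∑ l', w.loop l * v.loop l' * MvPolynomial.X (Sum.inl s(l, l')) := by
    rw [Finset.sum_comm]
    refine Finset.sum_congr rfl fun l _ => Finset.sum_congr rfl fun l' _ => ?_
    rw [Sym2.eq_swap, mul_comm (v.loop l')]
  have h2 : (∑ l, ∑ μ, MvPolynomial.C (metric μ : ℂ) *
        (v.loop l * w.par μ + w.loop l * v.par μ) *
          (MvPolynomial.X (Sum.inr (l, μ)) : Scalar ι n))
      = ∑ l, ∑ μ, MvPolynomial.C (metric μ : ℂ) *
        (w.loop l * v.par μ + v.loop l * w.par μ) * MvPolynomial.X (Sum.inr (l, μ)) :=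
    Finset.sum_congr rfl fun l _ => Finset.sum_congr rfl fun μ _ => by
      rw [add_comm (v.loop l * w.par μ)]
  have h3 : (∑ μ, MvPolynomial.C (metric μ : ℂ) * v.par μ * w.par μ : Scalar ι n)
      = ∑ μ, MvPolynomial.C (metric μ : ℂ) * w.par μ * v.par μ :=
    Finset.sum_congr rfl fun μ _ => mul_right_comm _ _ _
  rw [dot, dot, h1, h2, h3]

variable [DecidableEq ι]

/-- The integrated momentum `k_l`. -/
def loopVec (l : ι) : Vec ι n := ⟨Pi.single l 1, 0⟩

/-- The gradient of `f` with respect to `k_i`, from `∂(k_i · k_l) = k_l` for `l ≠ i`,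
`∂(k_i · k_i) = 2 k_i` and the chain rule. -/
def grad (i : ι) (f : Scalar ι n) : Vec ι n where
  loop l := (if l = i then 2 else 1) * MvPolynomial.pderiv (Sum.inl s(i, l)) f
  par μ := MvPolynomial.C (metric μ : ℂ) * MvPolynomial.pderiv (Sum.inr (i, μ)) f

/-- The directional derivative `v^μ ∂f/∂k_i^μ`. -/
def dirDeriv (i : ι) (v : Vec ι n) (f : Scalar ι n) : Scalar ι n := dot v (grad i f)

/-- The divergence `∂v^μ/∂k_i^μ` in `D` dimensions, by the product rule and
`∂k_l^μ/∂k_i^μ = D δ_{il}`. -/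
def divergence (D : ℂ) (i : ι) (v : Vec ι n) : Scalar ι n :=
  MvPolynomial.C D * v.loop i + (∑ l, dirDeriv i (loopVec l) (v.loop l))
    + ∑ μ, dirDeriv i (constVec (Pi.single μ 1)) (v.par μ)

end Calculus

/-! ### Propagators and integrands -/

/-- `P` propagators with momenta `q_j = ∑_l coeff_{jl} k_l + shift_j`, where the sum is over the
integrated momenta, and with squared masses `massSq_j`. -/
structure Propagators (ι : Type) (P n : ℕ) where
  /-- coefficients of the integrated momenta -/
  coeff : Fin P → ι → ℝ
  /-- the part of the momentum that is held fixed -/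
  shift : Fin P → Mink n
  /-- squared masses -/
  massSq : Fin P → ℝ

/-- Formal finite sums of the integrands `N / ∏_j (m_j^2 - q_j^2 - iε)^{ν_j}`, encoded as
`ν ↦ N`. -/
abbrev Integrand (ι : Type) (P n : ℕ) : Type := (Fin P → ℤ) →₀ Scalar ι n

namespace Propagators

variable {ι : Type} [Fintype ι] [DecidableEq ι] {P n : ℕ} (Φ : Propagators ι P n)

/-- The momentum `q_j`. -/
def momentum (j : Fin P) : Vec ι n where
  loop l := MvPolynomial.C (Φ.coeff j l : ℂ)
  par μ := MvPolynomial.C (Φ.shift j μ : ℂ)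

/-- The denominator `m_j^2 - q_j^2 - iε`. -/
def denom (ε : ℝ) (j : Fin P) : Scalar ι n :=
  MvPolynomial.C ((Φ.massSq j : ℂ) - Complex.I * ε) - dot (Φ.momentum j) (Φ.momentum j)

/-- The total derivative `∂/∂k_i^μ [v^μ N / ∏_j (m_j^2 - q_j^2 - iε)^{ν_j}]`, expanded by the
product rule. -/
def totalDeriv (ε : ℝ) (D : ℂ) (i : ι) (v : Vec ι n) (N : Scalar ι n) (ν : Fin P → ℤ) :
    Integrand ι P n :=
  Finsupp.single ν (divergence D i v * N + dirDeriv i v N)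
    + ∑ j, Finsupp.single (ν + Pi.single j 1)
        (-(MvPolynomial.C (ν j : ℂ) * N * dirDeriv i v (Φ.denom ε j)))

/-! ### Gaussian integrals in `D` dimensions

`∑_j α_j q_j^2 = ∑_{l,l'} A_{ll'} k_l · k_{l'} + 2 ∑_l b_l · k_l + ∑_j α_j shift_j^2`. -/

/-- The quadratic form `A`; its determinant is the first Symanzik polynomial. -/
def quadMatrix (α : Fin P → ℝ) : Matrix ι ι ℝ :=
  fun l l' => ∑ j, α j * Φ.coeff j l * Φ.coeff j l'

/-- The vectors `b_l`. -/
def linVec (α : Fin P → ℝ) (l : ι) : Mink n := ∑ j, (α j * Φ.coeff j l) • Φ.shift j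

/-- The stationary point `κ = -A⁻¹ b`. -/
def center (α : Fin P → ℝ) (l : ι) : Mink n := -∑ l', (Φ.quadMatrix α)⁻¹ l l' • Φ.linVec α l'

end Propagators

section Wick

variable {ι : Type} [Fintype ι] [DecidableEq ι] {n : ℕ}

/-- The value of `f` at `k_l = κ_l`. -/
def evalAt (κ : ι → Mink n) (f : Scalar ι n) : ℂ :=
  MvPolynomial.eval (Sum.elim
    (Sym2.lift ⟨fun l l' => (mdot (κ l) (κ l') : ℂ), fun l l' =>
      congrArg Complex.ofReal (mdot_comm (κ l) (κ l'))⟩)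
    (fun x => (κ x.1 x.2 : ℂ))) f

/-- The contraction `∑_{l,l'} B_{ll'} ∂_l · ∂_{l'} f` in `D` dimensions. -/
def contraction (D : ℂ) (B : Matrix ι ι ℝ) (f : Scalar ι n) : Scalar ι n :=
  ∑ l, ∑ l', MvPolynomial.C (B l l' : ℂ) * divergence D l (grad l' f)

/-- The mean of `f` with respect to `exp(i ∑ A_{ll'} (k_l - κ_l) · (k_{l'} - κ_{l'}))`, where
`B = A⁻¹`: by Wick's formula it is `exp((i/4) ∑ B_{ll'} ∂_l · ∂_{l'}) f` at `k = κ`. The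
exponential series stops, since a contraction lowers the degree. -/
def wickMean (D : ℂ) (B : Matrix ι ι ℝ) (κ : ι → Mink n) (f : Scalar ι n) : ℂ :=
  ∑ m ∈ Finset.range (f.totalDegree + 1),
    (Complex.I / 4) ^ m / (m.factorial : ℂ) * evalAt κ ((contraction D B)^[m] f)

end Wick

namespace Propagators

variable {ι : Type} [Fintype ι] [DecidableEq ι] {P n : ℕ} (Φ : Propagators ι P n)

/-- The Gaussian integral
`∫ ∏_l d^D k_l  f(k) exp(-i ∑_j α_j (m_j^2 - q_j^2 - iε))`,
with `∫ d^D k exp(i a k^2) = i π^{D/2} e^{-iπD/4} a^{-D/2}` for `a > 0` (there is one time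
direction). -/
def gaussIntegral (ε : ℝ) (D : ℂ) (α : Fin P → ℝ) (f : Scalar ι n) : ℂ :=
  (Complex.I * (Real.pi : ℂ) ^ (D / 2) * Complex.exp (-(Real.pi * Complex.I * D / 4)))
      ^ Fintype.card ι
    * ((Φ.quadMatrix α).det : ℂ) ^ (-D / 2)
    * Complex.exp (-Complex.I * (∑ j, (α j : ℂ) *
          ((Φ.massSq j : ℂ) - mdot (Φ.shift j) (Φ.shift j) - Complex.I * ε))
        - Complex.I * ∑ l, ∑ l',
          ((Φ.quadMatrix α)⁻¹ l l' * mdot (Φ.linVec α l) (Φ.linVec α l') : ℝ))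
    * wickMean D (Φ.quadMatrix α)⁻¹ (Φ.center α) f

/-- The Schwinger parametric integrand of `N / ∏_j (m_j^2 - q_j^2 - iε)^{ν_j}`. There is one
parameter for each `j` with `ν_j > 0`, from
`X^{-ν} = i^ν / Γ(ν) ∫_0^∞ dα α^{ν-1} e^{-iαX}` for `Im X < 0`;
factors with `ν_j ≤ 0` are polynomials and belong to the numerator. -/
def schwinger (ε : ℝ) (D : ℂ) (ν : Fin P → ℤ) (N : Scalar ι n)
    (α : {j : Fin P // 0 < ν j} → ℝ) : ℂ :=
  (∏ j, Complex.I ^ ν j.1 * (α j : ℂ) ^ (ν j.1 - 1) / Complex.Gamma (ν j.1 : ℂ))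
    * Φ.gaussIntegral ε D (fun j => if h : 0 < ν j then α ⟨j, h⟩ else 0)
        (N * ∏ j, if 0 < ν j then 1 else Φ.denom ε j ^ (-ν j).toNat)

/-- `G` is the dimensionally regulated integral over all `k_l`, `l : ι`, with measure
`∏_l d^D k_l`, of the integrand `T D`: a meromorphic function of `D` on the whole plane
(normalised at removable singularities) which is given by the absolutely convergent parametric
integral when `Re D` is sufficiently negative. -/
def IsDimRegIntegral (ε : ℝ) (T : ℂ → Integrand ι P n) (G : ℂ → ℂ) : Prop :=
  MeromorphicNFOn G Set.univ ∧
    ∃ c : ℝ, ∀ D : ℂ, D.re < c →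
      (∀ ν ∈ (T D).support, MeasureTheory.IntegrableOn
        (Φ.schwinger ε D ν (T D ν)) {α | ∀ j, 0 < α j}) ∧
      G D = (T D).sum fun ν N => ∫ α in {α | ∀ j, 0 < α j}, Φ.schwinger ε D ν N α

end Propagators

/-! ### Feynman integrands -/

/-- A Feynman integrand with loop momenta `k_1, …, k_L`, external momenta `p_1, …, p_E` and `P`
propagators of momenta `q_j = ∑_l a_{jl} k_l + ∑_e b_{je} p_e`. -/
structure FeynmanIntegrand (L E P n : ℕ) where
  /-- external momenta -/
  ext : Fin E → Mink n
  /-- propagator masses -/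
  mass : Fin P → ℝ
  /-- coefficients of the loop momenta -/
  loopCoeff : Fin P → Fin L → ℝ
  /-- coefficients of the external momenta -/
  extCoeff : Fin P → Fin E → ℝ
  /-- the propagator exponents -/
  exponent : Fin P → ℤ
  /-- the numerator, a polynomial in the `k_l · k_{l'}` and the `k_l · p_e` whose coefficients
  are functions of `D` -/
  numerator : MvPolynomial (Sym2 (Fin L) ⊕ Fin L × Fin E) (ℂ → ℂ)

namespace FeynmanIntegrand

variable {L E P n : ℕ} (F : FeynmanIntegrand L E P n) (S : Finset (Fin L)) (k : Fin L → Mink n)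

/-- The propagators, when the loop momenta in `S` are integrated over and the others have the
fixed values `k`. -/
def propagators : Propagators S P n where
  coeff j l := F.loopCoeff j l
  shift j := (∑ l ∈ Sᶜ, F.loopCoeff j l • k l) + ∑ e, F.extCoeff j e • F.ext e
  massSq j := F.mass j ^ 2

/-- The loop momentum `k_l`, a variable for `l ∈ S` and fixed otherwise. -/
def loopMomentum (l : Fin L) : Vec S n :=
  if h : l ∈ S then loopVec ⟨l, h⟩ else constVec (k l)

/-- The numerator at the dimension `D`. -/
def numeratorAt (D : ℂ) : Scalar S n :=
  MvPolynomial.aeval (Sum.elim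
    (Sym2.lift ⟨fun l l' => dot (loopMomentum S k l) (loopMomentum S k l'),
      fun _ _ => dot_comm _ _⟩)
    (fun x => dot (loopMomentum S k x.1) (constVec (F.ext x.2))))
    (F.numerator.map (Pi.evalRingHom (fun _ : ℂ => ℂ) D))

end FeynmanIntegrand

end DimReg

end

noncomputable section

namespace DimReg

open MvPolynomial

/-! ### Vector calculus on the independent scalars `k_l · k_l'` and `k_l^μ`. -/

section Calculus

variable {ι : Type} {n : ℕ}

/-! For complex `D` there is no space on which to integrate a total derivative, so the vanishing is
proved algebraically, under the Schwinger integral sign. All terms of the derivative can be given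
the same Gaussian. For `ν j > 0`, the derivative of `X_j^{-ν_j}` has exponent `ν_j + 1`, whose
parametric weight is the old one times `I * α_j / ν_j`; with the prefactor `-ν_j` this is the factor
`-I * α_j` that comes from differentiating `exp (-I * α_j * X_j)`. For `ν j < 0` the factor belongs
to the numerator and is differentiated there; for `ν j = 0` the term is zero. So at each `α` the
integrands add up to a Gaussian mean of `∂_i · u - ∑_j I α_j (u · ∂_i) X_j`, where `u` is the full
numerator times `v` (`schwingerOn_add_single`, `sum_factorDeriv`). Completing the square turns this
into `∂_i · u + 2 I ∑_l A_il (k_l - κ_l) · u` (`wickMean_total_derivative`).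

Its mean vanishes by Gaussian integration by parts, `⟨(k_l - κ_l) · u⟩ = (I/2) ∑_b (A⁻¹)_lb ⟨∂_b ·
u⟩` (`wickMean_dot`). This follows from Wick's formula by moving the factor `k_l` through the
contractions, using commutation relations that are identities between operators on polynomials and
hold for every complex `D`.

The integrals converge for very negative `Re D` (`integrableOn_schwinger`): the mean has poles of
bounded order in `det A`, which `(det A)^{-D/2}` cancels, the remaining growth is polynomial, and `ε
> 0` gives exponential decay. Hence the regulated integral is zero on a left half-plane, and a
meromorphic function in normal form that does so is zero (`eq_zero_of_meromorphicNFOn`). -/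

theorem Vec.ext' {v w : Vec ι n} (h : v.loop = w.loop) (h' : v.par = w.par) : v = w := by
  cases v; cases w; simp_all

instance : Add (Vec ι n) := ⟨fun v w => ⟨v.loop + w.loop, v.par + w.par⟩⟩

instance : Zero (Vec ι n) := ⟨⟨0, 0⟩⟩

instance : SMul (Scalar ι n) (Vec ι n) := ⟨fun f v => ⟨f • v.loop, f • v.par⟩⟩

theorem Vec.add_loop (v w : Vec ι n) : (v + w).loop = v.loop + w.loop := rfl
theorem Vec.add_par (v w : Vec ι n) : (v + w).par = v.par + w.par := rfl
theorem Vec.zero_loop : (0 : Vec ι n).loop = 0 := rfl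
theorem Vec.zero_par : (0 : Vec ι n).par = 0 := rfl
theorem Vec.smul_loop (f : Scalar ι n) (v : Vec ι n) : (f • v).loop = f • v.loop := rfl
theorem Vec.smul_par (f : Scalar ι n) (v : Vec ι n) : (f • v).par = f • v.par := rfl

theorem metric_mul_self (μ : Fin (n + 1)) : metric μ * metric μ = 1 := by
  unfold metric; split_ifs <;> norm_num

/-- The standard basis vector `e_μ` of `ℝ^{1,n}`. -/
abbrev basisVec (μ : Fin (n + 1)) : Vec ι n := constVec (Pi.single μ 1)

theorem basisVec_par (μ ν : Fin (n + 1)) :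
    (basisVec μ : Vec ι n).par ν = if ν = μ then 1 else 0 := by
  simp only [basisVec, constVec, Pi.single_apply]
  split_ifs <;> simp

variable [Fintype ι]

theorem dot_add (u v w : Vec ι n) : dot u (v + w) = dot u v + dot u w := by
  simp only [dot, Vec.add_loop, Vec.add_par, Pi.add_apply, mul_add, add_mul,
    Finset.sum_add_distrib]
  ring

theorem dot_smul (f : Scalar ι n) (u v : Vec ι n) : dot u (f • v) = f * dot u v := by
  rw [dot, dot, mul_add, mul_add]
  simp only [Vec.smul_loop, Vec.smul_par, Pi.smul_apply, smul_eq_mul, Finset.mul_sum]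
  refine congrArg₂ _ (congrArg₂ _ ?_ ?_) ?_
  · exact Finset.sum_congr rfl fun l _ => Finset.sum_congr rfl fun l' _ => by ring
  · exact Finset.sum_congr rfl fun l _ => Finset.sum_congr rfl fun μ _ => by ring
  · exact Finset.sum_congr rfl fun μ _ => by ring

theorem dot_zero (u : Vec ι n) : dot u 0 = 0 := by
  simp [dot, Vec.zero_loop, Vec.zero_par]

theorem add_dot (u v w : Vec ι n) : dot (u + v) w = dot u w + dot v w := by
  rw [dot_comm, dot_add, dot_comm w, dot_comm w]

theorem smul_dot (f : Scalar ι n) (u v : Vec ι n) : dot (f • u) v = f * dot u v := by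
  rw [dot_comm, dot_smul, dot_comm]

variable [DecidableEq ι]

theorem loopVec_dot (l : ι) (w : Vec ι n) :
    dot (loopVec l) w = (∑ l', w.loop l' * X (Sum.inl s(l, l')))
      + ∑ μ, C (metric μ : ℂ) * w.par μ * X (Sum.inr (l, μ)) := by
  simp [dot, loopVec, Pi.single_apply, ite_mul, Finset.sum_ite_eq']

omit [DecidableEq ι] in
theorem basisVec_dot (μ : Fin (n + 1)) (w : Vec ι n) :
    dot (basisVec μ) w
      = C (metric μ : ℂ) * ((∑ l, w.loop l * X (Sum.inr (l, μ))) + w.par μ) := by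
  have h : (basisVec μ : Vec ι n).loop = 0 := rfl
  simp only [dot, h, basisVec_par, Pi.zero_apply]
  simp [mul_add, Finset.mul_sum, mul_assoc]

theorem loopVec_dot_loopVec (l m : ι) :
    dot (loopVec l) (loopVec m : Vec ι n) = X (Sum.inl s(l, m)) := by
  rw [loopVec_dot]
  simp [loopVec, Pi.single_apply, ite_mul]

theorem loopVec_dot_basisVec (l : ι) (μ : Fin (n + 1)) :
    dot (loopVec l) (basisVec μ : Vec ι n) = C (metric μ : ℂ) * X (Sum.inr (l, μ)) := by
  rw [dot_comm, basisVec_dot]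
  simp [loopVec, Pi.single_apply, ite_mul]

theorem basisVec_dot_loopVec (l : ι) (μ : Fin (n + 1)) :
    dot (basisVec μ : Vec ι n) (loopVec l) = C (metric μ : ℂ) * X (Sum.inr (l, μ)) := by
  rw [dot_comm, loopVec_dot_basisVec]

omit [DecidableEq ι] in
theorem basisVec_dot_basisVec (μ ν : Fin (n + 1)) :
    dot (basisVec μ) (basisVec ν : Vec ι n) = if μ = ν then C (metric μ : ℂ) else 0 := by
  rw [basisVec_dot, basisVec_par]
  simp [constVec]

/-- Every vector is a combination of the `k_l` and `e_μ`, so identities linear in `u` need checking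
only on these. -/
theorem dot_eq_sum (u w : Vec ι n) :
    dot u w = (∑ l, u.loop l * dot (loopVec l) w) + ∑ μ, u.par μ * dot (basisVec μ) w := by
  simp only [loopVec_dot, basisVec_dot]
  rw [dot]
  simp only [mul_add, add_mul, Finset.mul_sum, Finset.sum_add_distrib]
  rw [Finset.sum_comm (s := (Finset.univ : Finset (Fin (n + 1)))) (t := Finset.univ)]
  have e1 : ∀ l : ι, ∀ l' : ι, u.loop l * (w.loop l' * (X (Sum.inl s(l, l')) : Scalar ι n))
    = u.loop l * w.loop l' * X (Sum.inl s(l, l')) := fun _ _ => by ring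
  have e2 : ∀ (l : ι) μ, u.loop l * (C (metric μ : ℂ) * w.par μ *
      (X (Sum.inr (l, μ)) : Scalar ι n))
    = C (metric μ : ℂ) * (u.loop l * w.par μ) * X (Sum.inr (l, μ)) := fun _ _ => by ring
  have e3 : ∀ (l : ι) μ, u.par μ * (C (metric μ : ℂ) * (w.loop l *
      (X (Sum.inr (l, μ)) : Scalar ι n)))
    = C (metric μ : ℂ) * (w.loop l * u.par μ) * X (Sum.inr (l, μ)) := fun _ _ => by ring
  have e4 : ∀ μ, u.par μ * (C (metric μ : ℂ) * w.par μ)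
    = C (metric μ : ℂ) * u.par μ * w.par μ := fun _ => by ring
  simp only [e1, e2, e3, e4]
  ring

omit [Fintype ι] in
theorem grad_add (a : ι) (f g : Scalar ι n) : grad a (f + g) = grad a f + grad a g := by
  apply Vec.ext' <;> funext <;> simp [grad, Vec.add_loop, Vec.add_par, mul_add]

omit [Fintype ι] in
theorem grad_C (a : ι) (c : ℂ) : grad a (C c : Scalar ι n) = 0 := by
  apply Vec.ext' <;> funext <;> simp [grad, Vec.zero_loop, Vec.zero_par]

omit [Fintype ι] in
theorem grad_mul (a : ι) (f g : Scalar ι n) :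
    grad a (f * g) = f • grad a g + g • grad a f := by
  apply Vec.ext' <;> funext <;>
    simp only [grad, Vec.add_loop, Vec.add_par, Vec.smul_loop, Vec.smul_par, pderiv_mul,
      Pi.add_apply, Pi.smul_apply, smul_eq_mul] <;> ring

omit [Fintype ι] in
theorem grad_X_inl (a l m : ι) : grad a (X (Sum.inl s(l, m)) : Scalar ι n)
    = (C (if a = l then 1 else 0) : Scalar ι n) • loopVec m
      + (C (if a = m then 1 else 0) : Scalar ι n) • loopVec l := by
  apply Vec.ext'
  · funext p
    simp only [grad, Vec.add_loop, Vec.smul_loop, pderiv_X, Pi.add_apply, Pi.smul_apply,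
      smul_eq_mul, loopVec, Pi.single_apply, Sum.inl.injEq, Sym2.eq_iff]
    -- When `l = m = a`, the two equal terms on the right match the factor 2 in `grad`.
    by_cases h1 : l = a <;> by_cases h2 : m = p <;> by_cases h3 : m = a <;>
      by_cases h4 : l = p <;> by_cases h5 : p = a <;> simp_all [eq_comm] <;> norm_num
  · funext p
    simp only [grad, Vec.add_par, Vec.smul_par, pderiv_X, Pi.single_apply, loopVec, Pi.add_apply,
      Pi.smul_apply]
    simp

omit [Fintype ι] in
theorem grad_X_inr (a l : ι) (μ : Fin (n + 1)) : grad a (X (Sum.inr (l, μ)) : Scalar ι n)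
    = (C ((if a = l then 1 else 0) * (metric μ : ℂ)) : Scalar ι n) • basisVec μ := by
  apply Vec.ext'
  · funext p
    simp [grad, Vec.smul_loop, pderiv_X, Pi.single_apply, constVec]
  · funext p
    simp only [grad, Vec.smul_par, pderiv_X, Pi.smul_apply, basisVec_par, smul_eq_mul,
      Pi.single_apply, Sum.inr.injEq, Prod.mk.injEq]
    by_cases h1 : l = a <;> by_cases h2 : μ = p <;> simp_all [eq_comm]

theorem dirDeriv_add (a : ι) (u : Vec ι n) (f g : Scalar ι n) :
    dirDeriv a u (f + g) = dirDeriv a u f + dirDeriv a u g := by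
  rw [dirDeriv, grad_add, dot_add]; rfl

theorem dirDeriv_C (a : ι) (u : Vec ι n) (c : ℂ) : dirDeriv a u (C c) = 0 := by
  rw [dirDeriv, grad_C, dot_zero]

theorem dirDeriv_zero (a : ι) (u : Vec ι n) : dirDeriv a u 0 = 0 := by
  simpa only [C_0] using dirDeriv_C a u 0

theorem dirDeriv_mul (a : ι) (u : Vec ι n) (f g : Scalar ι n) :
    dirDeriv a u (f * g) = f * dirDeriv a u g + g * dirDeriv a u f := by
  rw [dirDeriv, grad_mul, dot_add, dot_smul, dot_smul]; rfl

theorem dirDeriv_X_inl (a l m : ι) (u : Vec ι n) : dirDeriv a u (X (Sum.inl s(l, m)))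
    = C (if a = l then 1 else 0) * dot u (loopVec m)
      + C (if a = m then 1 else 0) * dot u (loopVec l) := by
  rw [dirDeriv, grad_X_inl, dot_add, dot_smul, dot_smul]

theorem dirDeriv_X_inr (a l : ι) (μ : Fin (n + 1)) (u : Vec ι n) :
    dirDeriv a u (X (Sum.inr (l, μ)))
      = C ((if a = l then 1 else 0) * (metric μ : ℂ)) * dot u (basisVec μ) := by
  rw [dirDeriv, grad_X_inr, dot_smul]

theorem dirDeriv_eq_sum (a : ι) (u : Vec ι n) (f : Scalar ι n) :
    dirDeriv a u f = (∑ l, u.loop l * dirDeriv a (loopVec l) f)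
      + ∑ μ, u.par μ * dirDeriv a (basisVec μ) f := dot_eq_sum _ _

theorem add_dirDeriv (a : ι) (u v : Vec ι n) (f : Scalar ι n) :
    dirDeriv a (u + v) f = dirDeriv a u f + dirDeriv a v f := add_dot _ _ _

theorem smul_dirDeriv (a : ι) (u : Vec ι n) (f g : Scalar ι n) :
    dirDeriv a (f • u) g = f * dirDeriv a u g := smul_dot _ _ _

theorem divergence_add (D : ℂ) (a : ι) (u v : Vec ι n) :
    divergence D a (u + v) = divergence D a u + divergence D a v := by
  simp only [divergence, Vec.add_loop, Vec.add_par, Pi.add_apply, dirDeriv_add,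
    Finset.sum_add_distrib]
  ring

/-- The coefficients of `u` may themselves depend on the momenta; their derivatives are those
already present in the divergence of `u`. -/
theorem divergence_smul (D : ℂ) (a : ι) (f : Scalar ι n) (u : Vec ι n) :
    divergence D a (f • u) = f * divergence D a u + dirDeriv a u f := by
  rw [dirDeriv_eq_sum a u]
  simp only [divergence, Vec.smul_loop, Vec.smul_par, Pi.smul_apply, smul_eq_mul, dirDeriv_mul,
    Finset.sum_add_distrib, mul_add, Finset.mul_sum]
  ring

theorem divergence_loopVec (D : ℂ) (a l : ι) :
    divergence D a (loopVec l : Vec ι n) = C (if a = l then D else 0) := by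
  have h : ∀ m, dirDeriv a (loopVec m : Vec ι n) ((loopVec l : Vec ι n).loop m) = 0 := by
    intro m
    simp only [loopVec, Pi.single_apply]
    split_ifs
    · exact dirDeriv_C a _ 1
    · exact dirDeriv_zero a _
  have h' : ∀ μ, dirDeriv a (basisVec μ : Vec ι n) ((loopVec l : Vec ι n).par μ) = 0 := by
    exact fun μ => dirDeriv_zero a _
  simp only [divergence, h, h', Finset.sum_const_zero, add_zero]
  by_cases e : a = l <;> simp [loopVec, e]

theorem divergence_constVec (D : ℂ) (a : ι) (x : Mink n) :
    divergence D a (constVec x : Vec ι n) = 0 := by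
  have h : ∀ m, dirDeriv a (loopVec m : Vec ι n) ((constVec x : Vec ι n).loop m) = 0 :=
    fun m => dirDeriv_zero a _
  have h' : ∀ μ, dirDeriv a (basisVec μ : Vec ι n) ((constVec x : Vec ι n).par μ) = 0 :=
    fun μ => dirDeriv_C a _ _
  simp only [divergence, h, h', Finset.sum_const_zero, add_zero]
  simp [constVec]

theorem divergence_zero (D : ℂ) (a : ι) : divergence D a (0 : Vec ι n) = 0 := by
  have := divergence_constVec D a (0 : Mink n)
  convert this
  apply Vec.ext' <;> funext <;> simp [constVec, Vec.zero_loop, Vec.zero_par]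

/-- The second-order operator `∂_a · ∂_b`. -/
def laplace (D : ℂ) (a b : ι) (f : Scalar ι n) : Scalar ι n := divergence D a (grad b f)

theorem laplace_add (D : ℂ) (a b : ι) (f g : Scalar ι n) :
    laplace D a b (f + g) = laplace D a b f + laplace D a b g := by
  rw [laplace, grad_add, divergence_add]; rfl

theorem laplace_C (D : ℂ) (a b : ι) (c : ℂ) : laplace D a b (C c : Scalar ι n) = 0 := by
  rw [laplace, grad_C, divergence_zero]

theorem laplace_mul (D : ℂ) (a b : ι) (f g : Scalar ι n) :
    laplace D a b (f * g) = f * laplace D a b g + g * laplace D a b f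
      + dirDeriv b (grad a f) g + dirDeriv a (grad b f) g := by
  rw [laplace, grad_mul, divergence_add, divergence_smul, divergence_smul]
  have : dirDeriv a (grad b g) f = dirDeriv b (grad a f) g := dot_comm _ _
  rw [this]
  simp only [laplace]
  ring

theorem laplace_X_inr_mul (D : ℂ) (a b p : ι) (μ : Fin (n + 1)) (f : Scalar ι n) :
    laplace D a b (X (Sum.inr (p, μ)) * f) = X (Sum.inr (p, μ)) * laplace D a b f
      + C (metric μ : ℂ) * (C (if a = p then 1 else 0) * dirDeriv b (basisVec μ) f
        + C (if b = p then 1 else 0) * dirDeriv a (basisVec μ) f) := by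
  rw [laplace_mul]
  simp only [laplace, grad_X_inr, divergence_smul, divergence_constVec, dirDeriv_C,
    smul_dirDeriv]
  simp only [C_mul]
  ring

/-- The term with `D` is `∂_a · ∂_b (k_p · k_q)`. It is the only place where the dimension enters
the relations below: a component `k_p^μ` has constant gradient and contributes no such term. -/
theorem laplace_X_inl_mul (D : ℂ) (a b p q : ι) (f : Scalar ι n) :
    laplace D a b (X (Sum.inl s(p, q)) * f) = X (Sum.inl s(p, q)) * laplace D a b f
      + C D * (C (if a = p then 1 else 0) * C (if b = q then 1 else 0)
          + C (if a = q then 1 else 0) * C (if b = p then 1 else 0)) * f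
      + C (if a = p then 1 else 0) * dirDeriv b (loopVec q) f
      + C (if a = q then 1 else 0) * dirDeriv b (loopVec p) f
      + C (if b = p then 1 else 0) * dirDeriv a (loopVec q) f
      + C (if b = q then 1 else 0) * dirDeriv a (loopVec p) f := by
  have h : ∀ x y : ι, (C (if x = y then D else 0) : Scalar ι n)
    = C D * C (if x = y then 1 else 0) := fun x y => by split_ifs <;> simp
  rw [laplace_mul]
  simp only [laplace, grad_X_inl, divergence_add, divergence_smul, divergence_loopVec, dirDeriv_C,
    smul_dirDeriv, add_dirDeriv, h]
  ring

end Calculus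

end DimReg

namespace DimReg

open MvPolynomial

/-! ### Commutation relations of first- and second-order operators, for every complex `D`. -/

section Commutators

variable {ι : Type} [Fintype ι] [DecidableEq ι] {n : ℕ}

omit [Fintype ι] [DecidableEq ι] in
-- An operator is determined by its values on constants and its commutators with multiplication by
-- the generators. The operator identities below are proved by this induction.
theorem scalar_induction {p : Scalar ι n → Prop} (f : Scalar ι n) (hC : ∀ c, p (C c))
    (hadd : ∀ f g, p f → p g → p (f + g))
    (hl : ∀ l m f, p f → p (X (Sum.inl s(l, m)) * f))
    (hr : ∀ l μ f, p f → p (X (Sum.inr (l, μ)) * f)) : p f := by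
  induction f using MvPolynomial.induction_on with
  | C a => exact hC a
  | add f g hf hg => exact hadd f g hf hg
  | mul_X f v hf =>
    rw [mul_comm]
    rcases v with z | ⟨l, μ⟩
    · induction z using Sym2.ind with
      | _ l m => exact hl l m f hf
    · exact hr l μ f hf

/-- The derivative `∑_a β_a u · ∂_a`. -/
def dirD (β : ι → ℂ) (u : Vec ι n) (f : Scalar ι n) : Scalar ι n :=
  ∑ a, C (β a) * dirDeriv a u f

theorem dirD_add (β : ι → ℂ) (u : Vec ι n) (f g : Scalar ι n) :
    dirD β u (f + g) = dirD β u f + dirD β u g := by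
  simp only [dirD, dirDeriv_add, mul_add, Finset.sum_add_distrib]

theorem dirD_C (β : ι → ℂ) (u : Vec ι n) (c : ℂ) : dirD β u (C c) = 0 := by
  simp [dirD, dirDeriv_C]

theorem dirD_zero (β : ι → ℂ) (u : Vec ι n) : dirD β u 0 = 0 := by
  simp [dirD, dirDeriv_zero]

theorem dirD_mul (β : ι → ℂ) (u : Vec ι n) (f g : Scalar ι n) :
    dirD β u (f * g) = f * dirD β u g + dirD β u f * g := by
  simp only [dirD, dirDeriv_mul, mul_add, Finset.sum_add_distrib, Finset.mul_sum, Finset.sum_mul]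
  exact congrArg₂ _ (Finset.sum_congr rfl fun _ _ => by ring)
    (Finset.sum_congr rfl fun _ _ => by ring)

theorem C_ite_eq_sum (β : ι → ℂ) (p : ι) (f : ι → Scalar ι n) :
    ∑ a, C (β a) * (C (if a = p then 1 else 0) * f a) = C (β p) * f p := by
  rw [Finset.sum_eq_single p] <;> simp +contextual

theorem dirD_X_inl (β : ι → ℂ) (p q : ι) (u : Vec ι n) : dirD β u (X (Sum.inl s(p, q)))
    = C (β p) * dot u (loopVec q) + C (β q) * dot u (loopVec p) := by
  simp only [dirD, dirDeriv_X_inl, mul_add, Finset.sum_add_distrib]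
  rw [C_ite_eq_sum β p fun _ => dot u (loopVec q), C_ite_eq_sum β q fun _ => dot u (loopVec p)]

theorem dirD_X_inr (β : ι → ℂ) (p : ι) (μ : Fin (n + 1)) (u : Vec ι n) :
    dirD β u (X (Sum.inr (p, μ))) = C (β p) * (C (metric μ : ℂ) * dot u (basisVec μ)) := by
  simp only [dirD, dirDeriv_X_inr, C_mul, mul_assoc]
  rw [C_ite_eq_sum β p fun _ => C (metric μ : ℂ) * dot u (basisVec μ)]

theorem dirD_basisVec_X_inl (β : ι → ℂ) (p q : ι) (μ : Fin (n + 1)) :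
    dirD β (basisVec μ : Vec ι n) (X (Sum.inl s(p, q))) = C (metric μ : ℂ) *
      (C (β p) * X (Sum.inr (q, μ)) + C (β q) * X (Sum.inr (p, μ))) := by
  rw [dirD_X_inl, basisVec_dot_loopVec, basisVec_dot_loopVec]; ring

theorem dirD_basisVec_X_inr (β : ι → ℂ) (p : ι) (μ ν : Fin (n + 1)) :
    dirD β (basisVec μ : Vec ι n) (X (Sum.inr (p, ν))) = C (β p * if μ = ν then 1 else 0) := by
  rw [dirD_X_inr, basisVec_dot_basisVec]
  split_ifs with h
  · rw [h, ← C_mul, ← C_mul, ← Complex.ofReal_mul, metric_mul_self]; simp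
  · simp

theorem dirD_loopVec_X_inl (β : ι → ℂ) (p q m : ι) :
    dirD β (loopVec m : Vec ι n) (X (Sum.inl s(p, q))) =
      C (β p) * X (Sum.inl s(m, q)) + C (β q) * X (Sum.inl s(m, p)) := by
  rw [dirD_X_inl, loopVec_dot_loopVec, loopVec_dot_loopVec]

theorem dirD_loopVec_X_inr (β : ι → ℂ) (p m : ι) (μ : Fin (n + 1)) :
    dirD β (loopVec m : Vec ι n) (X (Sum.inr (p, μ))) = C (β p) * X (Sum.inr (m, μ)) := by
  rw [dirD_X_inr, loopVec_dot_basisVec, ← mul_assoc (C _) (C _) (X _), ← C_mul,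
    ← Complex.ofReal_mul, metric_mul_self]; simp

/-- The operator `∑_{a,b} β_a γ_b ∂_a · ∂_b`. -/
def lap (D : ℂ) (β γ : ι → ℂ) (f : Scalar ι n) : Scalar ι n :=
  ∑ a, C (β a) * ∑ b, C (γ b) * laplace D a b f

theorem lap_add (D : ℂ) (β γ : ι → ℂ) (f g : Scalar ι n) :
    lap D β γ (f + g) = lap D β γ f + lap D β γ g := by
  simp only [lap, laplace_add, mul_add, Finset.sum_add_distrib]

theorem lap_C (D : ℂ) (β γ : ι → ℂ) (c : ℂ) : lap D β γ (C c : Scalar ι n) = 0 := by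
  simp [lap, laplace_C]

theorem lap_zero (D : ℂ) (β γ : ι → ℂ) : lap D β γ (0 : Scalar ι n) = 0 := by
  simpa only [C_0] using lap_C D β γ 0

theorem lap_X_inr_mul (D : ℂ) (β γ : ι → ℂ) (p : ι) (μ : Fin (n + 1)) (f : Scalar ι n) :
    lap D β γ (X (Sum.inr (p, μ)) * f) = X (Sum.inr (p, μ)) * lap D β γ f
      + C (metric μ : ℂ) * (C (β p) * dirD γ (basisVec μ) f
        + C (γ p) * dirD β (basisVec μ) f) := by
  have e : ∀ a b, laplace D a b (X (Sum.inr (p, μ)) * f)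
      = X (Sum.inr (p, μ)) * laplace D a b f
      + C (if a = p then 1 else 0) * (C (metric μ : ℂ) * dirDeriv b (basisVec μ) f)
      + C (if b = p then 1 else 0) * (C (metric μ : ℂ) * dirDeriv a (basisVec μ) f) := by
    intro a b; rw [laplace_X_inr_mul]; ring
  simp only [lap, e, mul_add, Finset.sum_add_distrib]
  have e1 : ∀ a, ∑ b, C (γ b) * (C (if a = p then 1 else 0) *
      (C (metric μ : ℂ) * dirDeriv b (basisVec μ) f))
      = C (if a = p then 1 else 0) * (C (metric μ : ℂ) * dirD γ (basisVec μ) f) := by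
    intro a
    simp only [dirD, Finset.mul_sum]
    exact Finset.sum_congr rfl fun _ _ => by ring
  simp only [e1, C_ite_eq_sum]
  rw [dirD, dirD]
  simp only [Finset.mul_sum]
  rw [add_assoc]
  refine congrArg₂ _ ?_ (congrArg₂ _ ?_ ?_)
  · exact Finset.sum_congr rfl fun a _ => Finset.sum_congr rfl fun b _ => by ring
  · exact Finset.sum_congr rfl fun a _ => by ring
  · exact Finset.sum_congr rfl fun a _ => by ring

theorem lap_X_inl_mul (D : ℂ) (β γ : ι → ℂ) (p q : ι) (f : Scalar ι n) :
    lap D β γ (X (Sum.inl s(p, q)) * f) = X (Sum.inl s(p, q)) * lap D β γ f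
      + C D * (C (β p) * C (γ q) + C (β q) * C (γ p)) * f
      + C (β p) * dirD γ (loopVec q) f + C (β q) * dirD γ (loopVec p) f
      + C (γ p) * dirD β (loopVec q) f + C (γ q) * dirD β (loopVec p) f := by
  have e : ∀ a b, laplace D a b (X (Sum.inl s(p, q)) * f)
      = X (Sum.inl s(p, q)) * laplace D a b f
      + C (if b = q then 1 else 0) * (C (if a = p then 1 else 0) * (C D * f))
      + C (if b = p then 1 else 0) * (C (if a = q then 1 else 0) * (C D * f))
      + C (if a = p then 1 else 0) * dirDeriv b (loopVec q) f
      + C (if a = q then 1 else 0) * dirDeriv b (loopVec p) f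
      + C (if b = p then 1 else 0) * dirDeriv a (loopVec q) f
      + C (if b = q then 1 else 0) * dirDeriv a (loopVec p) f := by
    intro a b; rw [laplace_X_inl_mul]; ring
  simp only [lap, e, mul_add, Finset.sum_add_distrib]
  have e1 : ∀ a r s : ι, ∑ b, C (γ b) * (C (if a = r then 1 else 0) * dirDeriv b (loopVec s) f)
      = C (if a = r then 1 else 0) * dirD γ (loopVec s) f := by
    intro a r s
    simp only [dirD, Finset.mul_sum]
    exact Finset.sum_congr rfl fun _ _ => by ring
  have e2 : ∀ r (a s : ι), C (γ r) * (C (if a = s then 1 else 0) * (C D * f))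
      = C (if a = s then 1 else 0) * (C (γ r) * (C D * f)) := fun _ _ _ => by ring
  have e4 : ∀ r s, ∑ a, C (β a) * (C (γ r) * dirDeriv a (loopVec s) f)
      = C (γ r) * dirD β (loopVec s) f := by
    intro r s
    simp only [dirD, Finset.mul_sum]
    exact Finset.sum_congr rfl fun _ _ => by ring
  simp only [e1, C_ite_eq_sum, e2, e4]
  have e5 : ∑ a, C (β a) * ∑ b, C (γ b) * (X (Sum.inl s(p, q)) * laplace D a b f)
      = X (Sum.inl s(p, q)) * ∑ a, C (β a) * ∑ b, C (γ b) * laplace D a b f := by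
    simp only [Finset.mul_sum]
    exact Finset.sum_congr rfl fun a _ => Finset.sum_congr rfl fun b _ => by ring
  rw [e5]
  ring

theorem lap_C_mul (D : ℂ) (β γ : ι → ℂ) (c : ℂ) (f : Scalar ι n) :
    lap D β γ (C c * f) = C c * lap D β γ f := by
  induction f using scalar_induction with
  | hC d => rw [← C_mul, lap_C, lap_C, mul_zero]
  | hadd f g hf hg => rw [mul_add, lap_add, lap_add, hf, hg, mul_add]
  | hl l m f hf =>
    rw [mul_left_comm]
    simp only [lap_X_inl_mul, hf, dirD_mul, dirD_C]; ring
  | hr l μ f hf =>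
    rw [mul_left_comm]
    simp only [lap_X_inr_mul, hf, dirD_mul, dirD_C]; ring

theorem dirD_comm_basisVec (β γ : ι → ℂ) (μ ν : Fin (n + 1)) (f : Scalar ι n) :
    dirD β (basisVec μ) (dirD γ (basisVec ν) f) = dirD γ (basisVec ν) (dirD β (basisVec μ) f) := by
  induction f using scalar_induction with
  | hC c => simp only [dirD_C, dirD_zero]
  | hadd f g hf hg => simp only [dirD_add, hf, hg]
  | hl p q f hf =>
    simp only [dirD_mul, dirD_add, dirD_C, dirD_basisVec_X_inl, dirD_basisVec_X_inr, hf]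
    by_cases h : μ = ν
    · subst h; simp only [if_true, mul_one]; ring
    · simp only [if_neg h, if_neg (Ne.symm h), mul_zero, C_0]; ring
  | hr p μ f hf =>
    simp only [dirD_mul, dirD_add, dirD_C, dirD_basisVec_X_inr, hf]; ring

/-- The extra term arises because `e_μ · ∂` also differentiates the coefficient `k_m` of `k_m · ∂`.
-/
theorem dirD_basisVec_loopVec (β γ : ι → ℂ) (μ : Fin (n + 1)) (m : ι) (f : Scalar ι n) :
    dirD β (basisVec μ) (dirD γ (loopVec m) f)
      = dirD γ (loopVec m) (dirD β (basisVec μ) f) + C (β m) * dirD γ (basisVec μ) f := by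
  induction f using scalar_induction with
  | hC c => simp only [dirD_C, dirD_zero]; ring
  | hadd f g hf hg => simp only [dirD_add, hf, hg]; ring
  | hl p q f hf =>
    simp only [dirD_mul, dirD_add, dirD_C, dirD_basisVec_X_inl,
      dirD_loopVec_X_inl, dirD_loopVec_X_inr, hf]
    ring
  | hr p ν f hf =>
    simp only [dirD_mul, dirD_add, dirD_C, dirD_basisVec_X_inr,
      dirD_loopVec_X_inr, hf]
    simp only [C_mul]
    ring

/-- These are the relations of the general linear Lie algebra acting on the loop momenta. -/
theorem dirD_loopVec_loopVec (β γ : ι → ℂ) (l m : ι) (f : Scalar ι n) :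
    dirD β (loopVec l) (dirD γ (loopVec m) f) + C (γ l) * dirD β (loopVec m) f
      = dirD γ (loopVec m) (dirD β (loopVec l) f) + C (β m) * dirD γ (loopVec l) f := by
  induction f using scalar_induction with
  | hC c => simp only [dirD_C, dirD_zero]; ring
  | hadd f g hf hg => simp only [dirD_add]; linear_combination hf + hg
  | hl p q f hf =>
    simp only [dirD_mul, dirD_add, dirD_C, dirD_loopVec_X_inl]
    rw [Sym2.eq_swap (a := m) (b := l)]
    linear_combination (X (Sum.inl s(p, q))) * hf
  | hr p ν f hf =>
    simp only [dirD_mul, dirD_add, dirD_C, dirD_loopVec_X_inr]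
    linear_combination (X (Sum.inr (p, ν))) * hf

omit [Fintype ι] [DecidableEq ι] in
theorem C_metric_mul_self (μ : Fin (n + 1)) :
    (C (metric μ : ℂ) : Scalar ι n) * C (metric μ : ℂ) = 1 := by
  rw [← C_mul, ← Complex.ofReal_mul, metric_mul_self]; simp

theorem lap_dirD_basisVec (D : ℂ) (β γ δ : ι → ℂ) (μ : Fin (n + 1)) (f : Scalar ι n) :
    lap D β γ (dirD δ (basisVec μ) f) = dirD δ (basisVec μ) (lap D β γ f) := by
  induction f using scalar_induction with
  | hC c => simp only [dirD_C, lap_zero, lap_C, dirD_zero]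
  | hadd f g hf hg => simp only [dirD_add, lap_add, hf, hg]
  | hl p q f hf =>
    simp only [dirD_mul, dirD_add, dirD_C, lap_X_inl_mul, lap_X_inr_mul, lap_add, lap_C_mul,
      dirD_basisVec_X_inl, dirD_basisVec_loopVec, hf, mul_assoc, add_mul]
    linear_combination (C (δ p) * (C (β q) * dirD γ (basisVec μ) f
      + C (γ q) * dirD β (basisVec μ) f) + C (δ q) * (C (β p) * dirD γ (basisVec μ) f
      + C (γ p) * dirD β (basisVec μ) f)) * C_metric_mul_self (ι := ι) μ
  | hr p ν f hf =>
    simp only [dirD_mul, dirD_add, dirD_C, lap_X_inr_mul, lap_add, lap_C_mul,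
      dirD_basisVec_X_inr, hf, dirD_comm_basisVec δ _ μ]
    ring

/-- Either of the two derivatives in `lap` may hit the coefficient `k_m`. -/
theorem lap_dirD_loopVec (D : ℂ) (β γ δ : ι → ℂ) (m : ι) (f : Scalar ι n) :
    lap D β γ (dirD δ (loopVec m) f) = dirD δ (loopVec m) (lap D β γ f)
      + C (β m) * lap D γ δ f + C (γ m) * lap D β δ f := by
  induction f using scalar_induction with
  | hC c => simp only [dirD_C, lap_zero, lap_C, dirD_zero]; ring
  | hadd f g hf hg => simp only [dirD_add, lap_add, hf, hg]; ring
  | hl p q f hf =>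
    have h1 := fun η r => dirD_loopVec_loopVec δ η m r f
    simp only [dirD_mul, dirD_add, dirD_C, lap_X_inl_mul, lap_add, lap_C_mul,
      dirD_loopVec_X_inl, hf, mul_assoc, add_mul]
    linear_combination - C (β p) * h1 γ q - C (β q) * h1 γ p - C (γ p) * h1 β q
      - C (γ q) * h1 β p
  | hr p ν f hf =>
    simp only [dirD_mul, dirD_add, dirD_C, lap_X_inr_mul, lap_add, lap_C_mul,
      dirD_loopVec_X_inr, hf, dirD_basisVec_loopVec, mul_assoc]
    ring

theorem lap_symm (D : ℂ) (β γ : ι → ℂ) (f : Scalar ι n) : lap D β γ f = lap D γ β f := by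
  induction f using scalar_induction with
  | hC c => simp only [lap_C]
  | hadd f g hf hg => simp only [lap_add, hf, hg]
  | hl p q f hf => simp only [lap_X_inl_mul, hf]; ring
  | hr p ν f hf => simp only [lap_X_inr_mul, hf]; ring

/-- Constant-coefficient operators commute. Since no underlying coordinates exist, this has to be
derived from the preceding relations. -/
theorem lap_comm (D : ℂ) (β γ δ η : ι → ℂ) (f : Scalar ι n) :
    lap D β γ (lap D δ η f) = lap D δ η (lap D β γ f) := by
  induction f using scalar_induction with
  | hC c => simp only [lap_zero, lap_C]
  | hadd f g hf hg => simp only [lap_add, hf, hg]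
  | hl p q f hf =>
    simp only [lap_X_inl_mul, lap_add, lap_C_mul, lap_dirD_loopVec, hf, mul_assoc, add_mul]
    rw [lap_symm D γ η, lap_symm D γ δ, lap_symm D β η, lap_symm D β δ]
    ring
  | hr p ν f hf =>
    simp only [lap_X_inr_mul, lap_add, lap_C_mul, lap_dirD_basisVec, hf]
    ring

end Commutators

end DimReg

namespace DimReg

open MvPolynomial

/-! ### Moving a momentum through iterated Wick contractions. -/

section Contraction

variable {ι : Type} [Fintype ι] [DecidableEq ι] {n : ℕ}

/-- A row of a real matrix, with complex entries. -/
def row (B : Matrix ι ι ℝ) (a : ι) : ι → ℂ := fun b => (B a b : ℂ)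

theorem dirD_single (a : ι) (u : Vec ι n) (f : Scalar ι n) :
    dirD (Pi.single a 1) u f = dirDeriv a u f := by
  rw [dirD, Finset.sum_eq_single a] <;> simp +contextual

theorem lap_single (D : ℂ) (a : ι) (γ : ι → ℂ) (f : Scalar ι n) :
    lap D (Pi.single a 1) γ f = ∑ b, C (γ b) * laplace D a b f := by
  rw [lap, Finset.sum_eq_single a] <;> simp +contextual

theorem contraction_eq (D : ℂ) (B : Matrix ι ι ℝ) (f : Scalar ι n) :
    contraction D B f = ∑ a, lap D (Pi.single a 1) (row B a) f := by
  simp only [lap_single]; rfl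

theorem contraction_add (D : ℂ) (B : Matrix ι ι ℝ) (f g : Scalar ι n) :
    contraction D B (f + g) = contraction D B f + contraction D B g := by
  simp only [contraction_eq, lap_add, Finset.sum_add_distrib]

theorem contraction_C_mul (D : ℂ) (B : Matrix ι ι ℝ) (c : ℂ) (f : Scalar ι n) :
    contraction D B (C c * f) = C c * contraction D B f := by
  simp only [contraction_eq, lap_C_mul, Finset.mul_sum]

theorem sum_single_mul (p : ι) (F : ι → Scalar ι n) :
    ∑ a, C ((Pi.single a 1 : ι → ℂ) p) * F a = F p := by
  rw [Finset.sum_eq_single p]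
  · simp
  · intro b _ hb
    simp [Pi.single_eq_of_ne hb.symm]
  · simp

/-- Symmetry of `B` makes the two cross terms of the Leibniz rule equal, hence the factor 2 here and
in the following commutators. -/
theorem contraction_X_inr_mul (D : ℂ) {B : Matrix ι ι ℝ} (hB : B.IsSymm) (p : ι) (μ : Fin (n + 1))
    (f : Scalar ι n) : contraction D B (X (Sum.inr (p, μ)) * f)
      = X (Sum.inr (p, μ)) * contraction D B f
        + 2 * (C (metric μ : ℂ) * dirD (row B p) (basisVec μ) f) := by
  simp only [contraction_eq, lap_X_inr_mul, Finset.sum_add_distrib, ← Finset.mul_sum,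
    sum_single_mul p fun a => dirD (row B a) (basisVec μ) f, dirD_single]
  have : ∑ a, C (row B a p) * dirDeriv a (basisVec μ) f = dirD (row B p) (basisVec μ) f :=
    Finset.sum_congr rfl fun a _ => by rw [row, row, hB.apply p a]
  rw [this]; ring

theorem contraction_X_inl_mul (D : ℂ) {B : Matrix ι ι ℝ} (hB : B.IsSymm) (p q : ι)
    (f : Scalar ι n) : contraction D B (X (Sum.inl s(p, q)) * f)
      = X (Sum.inl s(p, q)) * contraction D B f
        + 2 * (C (D * row B p q) * f + dirD (row B p) (loopVec q) f
          + dirD (row B q) (loopVec p) f) := by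
  have h1 : ∀ r s, ∑ a, C (row B a r) * dirDeriv a (loopVec s) f
      = dirD (row B r) (loopVec s) f := fun r s =>
    Finset.sum_congr rfl fun a _ => by rw [row, row, hB.apply r a]
  have h2 : row B q p = row B p q := by rw [row, row, hB.apply p q]
  simp only [contraction_eq, lap_X_inl_mul, Finset.sum_add_distrib, ← Finset.mul_sum,
    ← Finset.sum_mul, sum_single_mul p fun a => dirD (row B a) (loopVec q) f,
    sum_single_mul q fun a => dirD (row B a) (loopVec p) f,
    sum_single_mul p fun a => C (row B a q), sum_single_mul q fun a => C (row B a p),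
    dirD_single, h1, h2, C_mul]
  ring

theorem constVec_dirDeriv (a : ι) (x : Mink n) (f : Scalar ι n) :
    dirDeriv a (constVec x) f = ∑ μ, C (x μ : ℂ) * dirDeriv a (basisVec μ) f := by
  rw [dirDeriv_eq_sum]
  simp [constVec]

theorem constVec_dirD (β : ι → ℂ) (x : Mink n) (f : Scalar ι n) :
    dirD β (constVec x) f = ∑ μ, C (x μ : ℂ) * dirD β (basisVec μ) f := by
  have h : dirD β (constVec x) f = ∑ a, C (β a) * ∑ μ, C (x μ : ℂ) * dirDeriv a (basisVec μ) f :=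
    Finset.sum_congr rfl fun a _ => congrArg _ (constVec_dirDeriv a x f)
  simp only [h, Finset.mul_sum]
  rw [Finset.sum_comm]
  simp only [dirD, Finset.mul_sum]
  exact Finset.sum_congr rfl fun a _ => Finset.sum_congr rfl fun b _ => by ring

theorem constVec_dot (x : Mink n) (u : Vec ι n) :
    dot (constVec x) u = ∑ μ, C (x μ : ℂ) * dot (basisVec μ) u := by
  rw [dot_eq_sum]
  simp [constVec]

theorem contraction_sum (D : ℂ) (B : Matrix ι ι ℝ) {κ : Type} (s : Finset κ)
    (F : κ → Scalar ι n) :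
    contraction D B (∑ x ∈ s, F x) = ∑ x ∈ s, contraction D B (F x) := by
  induction s using Finset.cons_induction with
  | empty => simp [contraction_eq, lap_zero]
  | cons a s ha ih => rw [Finset.sum_cons, Finset.sum_cons, contraction_add, ih]

theorem contraction_dirD_constVec (D : ℂ) (B : Matrix ι ι ℝ) (δ : ι → ℂ) (x : Mink n)
    (f : Scalar ι n) : contraction D B (dirD δ (constVec x) f)
      = dirD δ (constVec x) (contraction D B f) := by
  have h : ∀ μ, contraction D B (dirD δ (basisVec μ) f)
      = dirD δ (basisVec μ) (contraction D B f) := by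
    intro μ
    have : ∀ (s : Finset ι) (F : ι → Scalar ι n),
        dirD δ (basisVec μ) (∑ x ∈ s, F x) = ∑ x ∈ s, dirD δ (basisVec μ) (F x) := by
      intro s F
      induction s using Finset.cons_induction with
      | empty => simp [dirD_zero]
      | cons a s ha ih => rw [Finset.sum_cons, Finset.sum_cons, dirD_add, ih]
    simp only [contraction_eq, this, lap_dirD_basisVec]
  rw [constVec_dirD δ x f, constVec_dirD δ x (contraction D B f)]
  simp only [contraction_sum, contraction_C_mul, h]

theorem contraction_dirD_loopVec (D : ℂ) {B : Matrix ι ι ℝ} (hB : B.IsSymm) (δ : ι → ℂ) (m : ι)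
    (f : Scalar ι n) : contraction D B (dirD δ (loopVec m) f)
      = dirD δ (loopVec m) (contraction D B f) + 2 * lap D (row B m) δ f := by
  have : ∀ (s : Finset ι) (F : ι → Scalar ι n),
      dirD δ (loopVec m) (∑ x ∈ s, F x) = ∑ x ∈ s, dirD δ (loopVec m) (F x) := by
    intro s F
    induction s using Finset.cons_induction with
    | empty => simp [dirD_zero]
    | cons a s ha ih => rw [Finset.sum_cons, Finset.sum_cons, dirD_add, ih]
  simp only [contraction_eq, this, lap_dirD_loopVec, Finset.sum_add_distrib,
    sum_single_mul m fun a => lap D (row B a) δ f]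
  have h : ∑ a, C (row B a m) * lap D (Pi.single a 1) δ f = lap D (row B m) δ f := by
    simp only [lap_single]
    exact Finset.sum_congr rfl fun a _ => by rw [row, row, hB.apply m a]
  rw [h]; ring

theorem contraction_lap (D : ℂ) (B : Matrix ι ι ℝ) (γ δ : ι → ℂ) (f : Scalar ι n) :
    contraction D B (lap D γ δ f) = lap D γ δ (contraction D B f) := by
  have : ∀ (s : Finset ι) (F : ι → Scalar ι n),
      lap D γ δ (∑ x ∈ s, F x) = ∑ x ∈ s, lap D γ δ (F x) := by
    intro s F
    induction s using Finset.cons_induction with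
    | empty => simp [lap_zero]
    | cons a s ha ih => rw [Finset.sum_cons, Finset.sum_cons, lap_add, ih]
  simp only [contraction_eq, this]
  exact Finset.sum_congr rfl fun a _ => lap_comm _ _ _ _ _ _

theorem contraction_constVec_dot_mul (D : ℂ) {B : Matrix ι ι ℝ} (hB : B.IsSymm) (x : Mink n)
    (m : ι) (f : Scalar ι n) : contraction D B (dot (constVec x) (loopVec m) * f)
      = dot (constVec x) (loopVec m) * contraction D B f
        + 2 * dirD (row B m) (constVec x) f := by
  rw [constVec_dot x (loopVec m), constVec_dirD _ x f]
  simp only [basisVec_dot_loopVec, Finset.sum_mul, contraction_sum,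
    mul_assoc, contraction_C_mul, contraction_X_inr_mul D hB, Finset.mul_sum,
    ← Finset.sum_add_distrib]
  refine Finset.sum_congr rfl fun μ _ => ?_
  linear_combination 2 * C (x μ : ℂ) * dirD (row B m) (basisVec μ) f
    * C_metric_mul_self (ι := ι) μ

/-- The value at `κ` of the `m`-fold contraction. -/
def contractedValue (D : ℂ) (B : Matrix ι ι ℝ) (κ : ι → Mink n) (m : ℕ) (f : Scalar ι n) : ℂ :=
  evalAt κ ((contraction D B)^[m] f)

theorem contractedValue_add (D : ℂ) (B : Matrix ι ι ℝ) (κ : ι → Mink n) (m : ℕ)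
    (f g : Scalar ι n) : contractedValue D B κ m (f + g)
      = contractedValue D B κ m f + contractedValue D B κ m g := by
  induction m generalizing f g with
  | zero => simp [contractedValue, evalAt]
  | succ m ih =>
    simp only [contractedValue, Function.iterate_succ_apply, contraction_add] at ih ⊢
    exact ih _ _

theorem contractedValue_C_mul (D : ℂ) (B : Matrix ι ι ℝ) (κ : ι → Mink n) (m : ℕ)
    (c : ℂ) (f : Scalar ι n) : contractedValue D B κ m (C c * f)
      = c * contractedValue D B κ m f := by
  induction m generalizing f with
  | zero => simp [contractedValue, evalAt]
  | succ m ih =>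
    simp only [contractedValue, Function.iterate_succ_apply, contraction_C_mul] at ih ⊢
    exact ih _

theorem contractedValue_succ (D : ℂ) (B : Matrix ι ι ℝ) (κ : ι → Mink n) (m : ℕ)
    (f : Scalar ι n) : contractedValue D B κ (m + 1) f
      = contractedValue D B κ m (contraction D B f) := rfl

/-- The contracted value as a linear functional. -/
def contractedValueₗ (D : ℂ) (B : Matrix ι ι ℝ) (κ : ι → Mink n) (m : ℕ) :
    Scalar ι n →ₗ[ℂ] ℂ where
  toFun := contractedValue D B κ m
  map_add' := contractedValue_add D B κ m
  map_smul' c f := by rw [smul_eq_C_mul, contractedValue_C_mul]; rfl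

theorem contractedValue_sum (D : ℂ) (B : Matrix ι ι ℝ) (κ : ι → Mink n) (m : ℕ)
    {τ : Type} (s : Finset τ) (F : τ → Scalar ι n) : contractedValue D B κ m (∑ x ∈ s, F x)
      = ∑ x ∈ s, contractedValue D B κ m (F x) :=
  map_sum (contractedValueₗ D B κ m) _ _

theorem contractedValue_sub (D : ℂ) (B : Matrix ι ι ℝ) (κ : ι → Mink n) (m : ℕ)
    (f g : Scalar ι n) : contractedValue D B κ m (f - g)
      = contractedValue D B κ m f - contractedValue D B κ m g :=
  map_sub (contractedValueₗ D B κ m) _ _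

theorem contractedValue_two_mul (D : ℂ) (B : Matrix ι ι ℝ) (κ : ι → Mink n) (m : ℕ)
    (f : Scalar ι n) : contractedValue D B κ m (2 * f) = 2 * contractedValue D B κ m f := by
  rw [two_mul, contractedValue_add, two_mul]

/-- Although `k_l · k_l'` and `k_l^μ` are independent variables, evaluation respects the relations
between them at an actual point `κ`. -/
theorem evalAt_loopVec_dot (κ : ι → Mink n) (l : ι) (u : Vec ι n) :
    evalAt κ (dot (loopVec l) u) = evalAt κ (dot (constVec (κ l)) u) := by
  have h1 : ∀ m, evalAt κ (dot (loopVec m) (loopVec l))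
      = evalAt κ (dot (loopVec m) (constVec (κ l))) := by
    intro m
    rw [dot_comm, dot_comm (loopVec m), loopVec_dot_loopVec, constVec_dot]
    simp only [basisVec_dot_loopVec]
    simp only [evalAt, map_sum, map_mul, eval_X, eval_C, Sum.elim_inl, Sum.elim_inr,
      Sym2.lift_mk, mdot, Complex.ofReal_sum, Complex.ofReal_mul]
    exact Finset.sum_congr rfl fun _ _ => by ring
  have h2 : ∀ μ, evalAt κ (dot (basisVec μ) (loopVec l))
      = evalAt κ (dot (basisVec μ) (constVec (κ l))) := by
    intro μ
    rw [basisVec_dot_loopVec, basisVec_dot]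
    simp [evalAt, constVec]
  rw [dot_comm, dot_comm (constVec _), dot_eq_sum, dot_eq_sum u (constVec _)]
  simp only [evalAt, map_add, map_sum, map_mul] at h1 h2 ⊢
  simp only [h1, h2]

/-- Once no contraction is left to the outside, `k_l` takes the value `κ_l`. Each of the `m`
contractions passed on the way gives the same commutator, which commutes with the others, hence `2 *
m`. For `m = 0` the truncated `m - 1` is harmless because its coefficient vanishes. -/
theorem contractedValue_dirD_loopVec (D : ℂ) {B : Matrix ι ι ℝ} (hB : B.IsSymm) (κ : ι → Mink n)
    (β : ι → ℂ) (l : ι) (m : ℕ) (f : Scalar ι n) :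
    contractedValue D B κ m (dirD β (loopVec l) f) =
      contractedValue D B κ m (dirD β (constVec (κ l)) f)
      + 2 * m * contractedValue D B κ (m - 1) (lap D (row B l) β f) := by
  induction m generalizing f with
  | zero =>
    simp only [contractedValue, Function.iterate_zero, id, dirD, evalAt, map_sum, map_mul]
    simp only [CharP.cast_eq_zero, mul_zero, zero_mul, add_zero]
    exact Finset.sum_congr rfl fun a _ => congrArg _ (evalAt_loopVec_dot κ l (grad a f))
  | succ m ih =>
    rw [contractedValue_succ, contraction_dirD_loopVec D hB, contractedValue_add, ih,
      contractedValue_succ, contraction_dirD_constVec, contractedValue_two_mul]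
    rcases m with _ | m
    · simp
    · rw [← contraction_lap, Nat.add_sub_cancel, ← contractedValue_succ]
      simp only [Nat.add_sub_cancel]
      push_cast; ring

theorem contractedValue_dot_constVec (D : ℂ) {B : Matrix ι ι ℝ} (hB : B.IsSymm) (κ : ι → Mink n)
    (l : ι) (x : Mink n) (m : ℕ) (f : Scalar ι n) :
    contractedValue D B κ m (dot (loopVec l) (constVec x) * f)
      = contractedValue D B κ m (dot (constVec (κ l)) (constVec x) * f)
      + 2 * m * contractedValue D B κ (m - 1) (dirD (row B l) (constVec x) f) := by
  have hc : dot (constVec (κ l)) (constVec x : Vec ι n) = C (mdot (κ l) x : ℂ) := by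
    rw [constVec_dot]
    simp only [basisVec_dot]
    simp [constVec, mdot]
    exact Finset.sum_congr rfl fun _ _ => by ring
  induction m generalizing f with
  | zero =>
    have := evalAt_loopVec_dot κ l (constVec x)
    simp only [contractedValue, Function.iterate_zero, id, evalAt, map_mul] at this ⊢
    simp [this]
  | succ m ih =>
    rw [contractedValue_succ, dot_comm, contraction_constVec_dot_mul D hB, contractedValue_add,
      dot_comm, ih, contractedValue_two_mul, contractedValue_succ, hc, contraction_C_mul]
    rcases m with _ | m
    · simp
    · rw [← contraction_dirD_constVec, Nat.add_sub_cancel, ← contractedValue_succ]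
      simp only [Nat.add_sub_cancel]
      push_cast; ring

/-- Here the commutator contains `k_p · ∂`, which does not commute with further contractions. The
resulting corrections cancel those from replacing `k_l` by `κ_l` in the other cross term. -/
theorem contractedValue_dot_loopVec (D : ℂ) {B : Matrix ι ι ℝ} (hB : B.IsSymm) (κ : ι → Mink n)
    (l p : ι) (m : ℕ) (f : Scalar ι n) :
    contractedValue D B κ m (dot (loopVec l) (loopVec p) * f)
      = contractedValue D B κ m (dot (constVec (κ l)) (loopVec p) * f)
      + 2 * m * contractedValue D B κ (m - 1)
          (C (D * row B l p) * f + dirD (row B l) (loopVec p) f) := by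
  induction m generalizing f with
  | zero =>
    have := evalAt_loopVec_dot κ l (loopVec p)
    simp only [contractedValue, Function.iterate_zero, id, evalAt, map_mul] at this ⊢
    simp [this]
  | succ m ih =>
    -- The cross term with `k_l` must become one with `κ_l`, to match the contraction of `κ_l · k_p
    -- * f`; the price is a multiple of `lap D (row B l) (row B p) f`.
    have hs := contractedValue_dirD_loopVec D hB κ (row B p) l m f
    rw [contractedValue_succ, loopVec_dot_loopVec, contraction_X_inl_mul D hB,
      contractedValue_add, ← loopVec_dot_loopVec, ih, contractedValue_two_mul,
      contractedValue_succ D B κ m (dot _ _ * f), contraction_constVec_dot_mul D hB]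
    simp only [contractedValue_add, contractedValue_two_mul] at hs ⊢
    rcases m with _ | m
    · simp only [hs]; simp; ring
    · have h1 := contraction_dirD_loopVec D hB (row B l) p f
      rw [lap_symm] at h1
      -- This supplies the same second-order term with the opposite sign.
      have h2 : dirD (row B l) (loopVec p) (contraction D B f)
        = contraction D B (dirD (row B l) (loopVec p) f) - 2 * lap D (row B l) (row B p) f := by
        rw [h1]; ring
      rw [h2, ← contraction_C_mul]
      simp only [Nat.add_sub_cancel, contractedValue_sub,
        contractedValue_two_mul, ← contractedValue_succ] at hs ⊢
      rw [hs]
      push_cast; ring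

theorem divergence_eq_sum (D : ℂ) (b : ι) (u : Vec ι n) :
    divergence D b u = (∑ l, divergence D b (u.loop l • loopVec l))
      + ∑ μ, divergence D b (u.par μ • basisVec μ) := by
  simp only [divergence_smul, divergence_loopVec, divergence_constVec, Finset.sum_add_distrib,
    mul_zero, zero_add]
  rw [divergence]
  congr 2
  rw [Finset.sum_eq_single b]
  · simp [mul_comm]
  · intro a _ h; simp [Ne.symm h]
  · simp

/-- Integration by parts for the `m`-fold contraction. -/
theorem contractedValue_dot (D : ℂ) {B : Matrix ι ι ℝ} (hB : B.IsSymm) (κ : ι → Mink n)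
    (l : ι) (m : ℕ) (u : Vec ι n) :
    contractedValue D B κ m (dot (loopVec l) u)
      = contractedValue D B κ m (dot (constVec (κ l)) u)
      + 2 * m * ∑ b, (B l b : ℂ) * contractedValue D B κ (m - 1) (divergence D b u) := by
  have hsum : ∀ w : Vec ι n, ∑ b, (B l b : ℂ) * contractedValue D B κ (m - 1) (divergence D b w)
      = contractedValue D B κ (m - 1) (∑ b, C (B l b : ℂ) * divergence D b w) := by
    intro w
    simp only [contractedValue_sum, contractedValue_C_mul]
  have hl : ∀ p, contractedValue D B κ m (u.loop p * dot (loopVec p) (loopVec l))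
      = contractedValue D B κ m (u.loop p * dot (loopVec p) (constVec (κ l)))
      + 2 * m * ∑ b, (B l b : ℂ) *
        contractedValue D B κ (m - 1) (divergence D b (u.loop p • loopVec p)) := by
    intro p
    rw [mul_comm, dot_comm, contractedValue_dot_loopVec D hB, mul_comm, dot_comm, hsum]
    congr 3
    simp only [divergence_smul, divergence_loopVec, mul_add, Finset.sum_add_distrib]
    congr 1
    -- Only `b = p` survives, since `∂_b · k_p = D δ_bp`; this is the source of `D * row B l p` in
    -- `contractedValue_dot_loopVec`.
    rw [Finset.sum_eq_single p]
    · simp [row]; ring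
    · intro a _ h; simp [h]
    · simp
  have hr : ∀ μ, contractedValue D B κ m (u.par μ * dot (basisVec μ) (loopVec l))
      = contractedValue D B κ m (u.par μ * dot (basisVec μ) (constVec (κ l)))
      + 2 * m * ∑ b, (B l b : ℂ) *
        contractedValue D B κ (m - 1) (divergence D b (u.par μ • basisVec μ)) := by
    intro μ
    rw [mul_comm, dot_comm, contractedValue_dot_constVec D hB, mul_comm, dot_comm, hsum]
    simp only [divergence_smul, divergence_constVec, mul_zero, zero_add, dirD, row]
  rw [dot_comm, dot_comm (constVec _), dot_eq_sum, dot_eq_sum u (constVec _)]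
  simp only [contractedValue_add, contractedValue_sum, hl, hr]
  simp only [divergence_eq_sum D _ u, contractedValue_add, contractedValue_sum,
    Finset.sum_add_distrib, mul_add, Finset.mul_sum]
  rw [Finset.sum_comm, Finset.sum_comm (s := (Finset.univ : Finset (Fin (n + 1))))]
  ring

end Contraction

end DimReg

namespace DimReg

open MvPolynomial

/-! ### Contractions lower the degree, so Wick's series stops. -/

section Degree

theorem totalDegree_pderiv_le {σ : Type} (i : σ) (f : MvPolynomial σ ℂ) :
    (pderiv i f).totalDegree ≤ f.totalDegree - 1 := by
  refine Finset.sup_le fun m hm => ?_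
  rw [mem_support_iff, coeff_pderiv] at hm
  have h := le_totalDegree (mem_support_iff.mpr (left_ne_zero_of_mul hm))
  rw [Finsupp.sum_add_index' (fun _ => rfl) (fun _ _ _ => rfl), Finsupp.sum_single_index rfl] at h
  omega

variable {ι : Type} {n : ℕ}

theorem totalDegree_mul_le_of_le {σ : Type} {f g : MvPolynomial σ ℂ} {a b : ℕ}
    (hf : f.totalDegree ≤ a) (hg : g.totalDegree ≤ b) : (f * g).totalDegree ≤ a + b :=
  (totalDegree_mul f g).trans (add_le_add hf hg)

theorem totalDegree_add_le_of_le {σ : Type} {f g : MvPolynomial σ ℂ} {a : ℕ}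
    (hf : f.totalDegree ≤ a) (hg : g.totalDegree ≤ a) : (f + g).totalDegree ≤ a :=
  (totalDegree_add f g).trans (max_le hf hg)

theorem totalDegree_C_mul_le {σ : Type} {f : MvPolynomial σ ℂ} {a : ℕ} (c : ℂ)
    (hf : f.totalDegree ≤ a) : (C c * f).totalDegree ≤ a := by
  simpa using totalDegree_mul_le_of_le (totalDegree_C c).le hf

theorem totalDegree_grad_loop_le [DecidableEq ι] (a : ι) (f : Scalar ι n) (l : ι) :
    ((grad a f).loop l).totalDegree ≤ f.totalDegree - 1 := by
  have : (grad a f).loop l = C (if l = a then 2 else 1) * pderiv (Sum.inl s(a, l)) f := by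
    simp only [grad]
    split_ifs
    · rw [map_ofNat]
    · rw [C_1]
  rw [this]
  exact totalDegree_C_mul_le _ (totalDegree_pderiv_le _ _)

theorem totalDegree_grad_par_le [DecidableEq ι] (a : ι) (f : Scalar ι n) (μ : Fin (n + 1)) :
    ((grad a f).par μ).totalDegree ≤ f.totalDegree - 1 :=
  totalDegree_C_mul_le _ (totalDegree_pderiv_le _ _)

variable [Fintype ι] [DecidableEq ι]

/-- The gradient lowers the degree by one and the product with `k_l` restores at most one generator.
Degree zero is separate because `f.totalDegree - 1` is truncated. -/
theorem totalDegree_dirDeriv_loopVec_le (a l : ι) (f : Scalar ι n) :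
    (dirDeriv a (loopVec l) f).totalDegree ≤ f.totalDegree := by
  rcases Nat.eq_zero_or_pos f.totalDegree with h | h
  · rw [totalDegree_eq_zero_iff_eq_C.mp h, dirDeriv_C]; simp
  · have e : f.totalDegree = f.totalDegree - 1 + 1 := by omega
    rw [dirDeriv, loopVec_dot, e]
    refine totalDegree_add_le_of_le (totalDegree_finsetSum_le fun l' _ => ?_)
      (totalDegree_finsetSum_le fun μ _ => ?_)
    · exact totalDegree_mul_le_of_le (totalDegree_grad_loop_le _ _ _) (totalDegree_X _).le
    · exact totalDegree_mul_le_of_le (totalDegree_C_mul_le _ (totalDegree_grad_par_le _ _ _))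
        (totalDegree_X _).le

theorem totalDegree_dirDeriv_basisVec_le (a : ι) (μ : Fin (n + 1)) (f : Scalar ι n) :
    (dirDeriv a (basisVec μ) f).totalDegree ≤ f.totalDegree := by
  rcases Nat.eq_zero_or_pos f.totalDegree with h | h
  · rw [totalDegree_eq_zero_iff_eq_C.mp h, dirDeriv_C]; simp
  · have e : f.totalDegree = f.totalDegree - 1 + 1 := by omega
    rw [dirDeriv, basisVec_dot, e]
    refine totalDegree_C_mul_le _ (totalDegree_add_le_of_le
      (totalDegree_finsetSum_le fun l' _ => ?_) ?_)
    · exact totalDegree_mul_le_of_le (totalDegree_grad_loop_le _ _ _) (totalDegree_X _).le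
    · exact (totalDegree_grad_par_le _ _ _).trans (by omega)

theorem totalDegree_divergence_le (D : ℂ) (a : ι) {u : Vec ι n} {d : ℕ}
    (hl : ∀ l, (u.loop l).totalDegree ≤ d) (hp : ∀ μ, (u.par μ).totalDegree ≤ d) :
    (divergence D a u).totalDegree ≤ d := by
  refine totalDegree_add_le_of_le (totalDegree_add_le_of_le (totalDegree_C_mul_le _ (hl a))
    (totalDegree_finsetSum_le fun l _ => ?_)) (totalDegree_finsetSum_le fun μ _ => ?_)
  · exact (totalDegree_dirDeriv_loopVec_le a l _).trans (hl l)
  · exact (totalDegree_dirDeriv_basisVec_le a μ _).trans (hp μ)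

theorem totalDegree_laplace_le (D : ℂ) (a b : ι) (f : Scalar ι n) :
    (laplace D a b f).totalDegree ≤ f.totalDegree - 1 :=
  totalDegree_divergence_le D a (totalDegree_grad_loop_le b f) (totalDegree_grad_par_le b f)

theorem totalDegree_contraction_le (D : ℂ) (B : Matrix ι ι ℝ) (f : Scalar ι n) :
    (contraction D B f).totalDegree ≤ f.totalDegree - 1 :=
  totalDegree_finsetSum_le fun a _ => totalDegree_finsetSum_le fun b _ =>
    totalDegree_C_mul_le _ (totalDegree_laplace_le D a b f)

theorem contraction_C (D : ℂ) (B : Matrix ι ι ℝ) (c : ℂ) :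
    contraction D B (C c : Scalar ι n) = 0 := by
  simp [contraction_eq, lap_C]

theorem iterate_contraction_eq_zero (D : ℂ) (B : Matrix ι ι ℝ) (f : Scalar ι n) {m : ℕ}
    (hm : f.totalDegree < m) : (contraction D B)^[m] f = 0 := by
  induction m generalizing f with
  | zero => omega
  | succ m ih =>
    rw [Function.iterate_succ_apply]
    rcases Nat.eq_zero_or_pos f.totalDegree with h | h
    · rw [totalDegree_eq_zero_iff_eq_C.mp h, contraction_C]
      clear ih hm
      induction m with
      | zero => rfl
      | succ m ih =>
        have h0 := contraction_C (n := n) D B 0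
        rw [C_0] at h0
        rw [Function.iterate_succ_apply, h0]; exact ih
    · exact ih _ ((totalDegree_contraction_le D B f).trans_lt (by omega))

end Degree

/-! ### Gaussian means and integration by parts. -/

section Mean

variable {ι : Type} [Fintype ι] [DecidableEq ι] {n : ℕ}

/-- A partial sum of Wick's exponential series. -/
def wickSum (D : ℂ) (B : Matrix ι ι ℝ) (κ : ι → Mink n) (K : ℕ) : Scalar ι n →ₗ[ℂ] ℂ :=
  ∑ m ∈ Finset.range K, ((Complex.I / 4) ^ m / (m.factorial : ℂ)) • contractedValueₗ D B κ m

theorem wickSum_apply (D : ℂ) (B : Matrix ι ι ℝ) (κ : ι → Mink n) (K : ℕ) (f : Scalar ι n) :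
    wickSum D B κ K f = ∑ m ∈ Finset.range K,
      (Complex.I / 4) ^ m / (m.factorial : ℂ) * contractedValue D B κ m f := by
  simp [wickSum, contractedValueₗ]

/-- The truncation in `wickMean` depends on `f`, which hides linearity. Any longer sum has the same
value, so finitely many polynomials can share one truncation. -/
theorem wickMean_eq_wickSum (D : ℂ) (B : Matrix ι ι ℝ) (κ : ι → Mink n) {K : ℕ}
    {f : Scalar ι n} (hK : f.totalDegree < K) : wickMean D B κ f = wickSum D B κ K f := by
  rw [wickSum_apply, wickMean]
  refine Finset.sum_subset (Finset.range_mono hK) fun m _ hm => ?_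
  rw [Finset.mem_range, not_lt] at hm
  rw [iterate_contraction_eq_zero D B f hm]
  simp [evalAt]

theorem wickMean_add (D : ℂ) (B : Matrix ι ι ℝ) (κ : ι → Mink n) (f g : Scalar ι n) :
    wickMean D B κ (f + g) = wickMean D B κ f + wickMean D B κ g := by
  set K := max (max f.totalDegree g.totalDegree) (f + g).totalDegree + 1
  rw [wickMean_eq_wickSum D B κ (K := K) (f := f) (by omega),
    wickMean_eq_wickSum D B κ (K := K) (f := g) (by omega),
    wickMean_eq_wickSum D B κ (K := K) (f := f + g) (by omega), map_add]

theorem wickMean_C_mul (D : ℂ) (B : Matrix ι ι ℝ) (κ : ι → Mink n) (c : ℂ) (f : Scalar ι n) :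
    wickMean D B κ (C c * f) = c * wickMean D B κ f := by
  set K := max f.totalDegree (C c * f).totalDegree + 1
  rw [wickMean_eq_wickSum D B κ (K := K) (f := f) (by omega),
    wickMean_eq_wickSum D B κ (K := K) (f := C c * f) (by omega), ← smul_eq_C_mul, map_smul]
  rfl

/-- Wick's mean as a linear functional. -/
def wickMeanₗ (D : ℂ) (B : Matrix ι ι ℝ) (κ : ι → Mink n) : Scalar ι n →ₗ[ℂ] ℂ where
  toFun := wickMean D B κ
  map_add' := wickMean_add D B κ
  map_smul' c f := by rw [smul_eq_C_mul, wickMean_C_mul]; rfl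

theorem wickMean_zero (D : ℂ) (B : Matrix ι ι ℝ) (κ : ι → Mink n) :
    wickMean D B κ 0 = 0 := map_zero (wickMeanₗ D B κ)

theorem wickMean_sum (D : ℂ) (B : Matrix ι ι ℝ) (κ : ι → Mink n) {τ : Type} (s : Finset τ)
    (F : τ → Scalar ι n) : wickMean D B κ (∑ x ∈ s, F x) = ∑ x ∈ s, wickMean D B κ (F x) :=
  map_sum (wickMeanₗ D B κ) _ _

/-- By `contractedValue_dot`, the `m`-th term on the left acquires a factor `2 * m`, and `2 m
(I/4)^m / m! = (I/2) (I/4)^(m-1) / (m-1)!`: the left series is the right one shifted by one. -/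
theorem wickMean_dot (D : ℂ) {B : Matrix ι ι ℝ} (hB : B.IsSymm) (κ : ι → Mink n) (l : ι)
    (u : Vec ι n) : wickMean D B κ (dot (loopVec l) u - dot (constVec (κ l)) u)
      = Complex.I / 2 * ∑ b, (B l b : ℂ) * wickMean D B κ (divergence D b u) := by
  set K := max (dot (loopVec l) u - dot (constVec (κ l)) u).totalDegree
    (Finset.univ.sup fun b => (divergence D b u).totalDegree) + 1 with hK
  have h1 : ∀ b, wickMean D B κ (divergence D b u) = wickSum D B κ K (divergence D b u) := by
    intro b
    apply wickMean_eq_wickSum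
    have := Finset.le_sup (f := fun b => (divergence D b u).totalDegree) (Finset.mem_univ b)
    omega
  simp only [h1]
  -- One more term on the left, to be consumed by the shift; its `m = 0` term is zero.
  rw [wickMean_eq_wickSum D B κ (K := K + 1) (by omega)]
  simp only [wickSum_apply, contractedValue_sub, contractedValue_dot D hB κ l]
  rw [Finset.sum_range_succ']
  simp only [add_sub_cancel_left, Nat.add_sub_cancel, Nat.cast_zero, mul_zero, zero_mul, add_zero,
    Finset.mul_sum, Finset.sum_const_zero]
  rw [sub_self, mul_zero, add_zero, Finset.sum_comm]
  refine Finset.sum_congr rfl fun b _ => Finset.sum_congr rfl fun m _ => ?_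
  rw [Nat.factorial_succ]
  have : ((m : ℂ) + 1) ≠ 0 := Nat.cast_add_one_ne_zero m
  have : (m.factorial : ℂ) ≠ 0 := Nat.cast_ne_zero.mpr m.factorial_ne_zero
  push_cast
  field_simp
  ring

/-- Integration by parts for Gaussian means. -/
theorem wickMean_integration_by_parts (D : ℂ) {A : Matrix ι ι ℝ} (hA : A.IsSymm)
    (hdet : A.det ≠ 0) (κ : ι → Mink n) (i : ι) (u : Vec ι n) :
    wickMean D A⁻¹ κ (divergence D i u + C (2 * Complex.I) *
      ∑ l, C (A i l : ℂ) * (dot (loopVec l) u - dot (constVec (κ l)) u)) = 0 := by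
  have hB : (A⁻¹).IsSymm := by
    rw [Matrix.IsSymm, Matrix.transpose_nonsing_inv, hA.eq]
  have hAB : ∀ b, ∑ l, (A i l : ℂ) * (A⁻¹ l b : ℂ) = if i = b then 1 else 0 := by
    intro b
    have := congrFun (congrFun (Matrix.mul_nonsing_inv A (isUnit_iff_ne_zero.mpr hdet)) i) b
    rw [Matrix.mul_apply, Matrix.one_apply] at this
    have := congrArg (fun x : ℝ => (x : ℂ)) this
    simp only [Complex.ofReal_sum, Complex.ofReal_mul] at this
    rw [this]
    split_ifs <;> simp
  simp only [wickMean_add, wickMean_C_mul, wickMean_sum, wickMean_dot D hB]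
  have : ∑ l, (A i l : ℂ) * (Complex.I / 2 * ∑ b, (A⁻¹ l b : ℂ) *
        wickMean D A⁻¹ κ (divergence D b u))
      = Complex.I / 2 * wickMean D A⁻¹ κ (divergence D i u) := by
    calc _ = Complex.I / 2 * ∑ b, (∑ l, (A i l : ℂ) * (A⁻¹ l b : ℂ)) *
          wickMean D A⁻¹ κ (divergence D b u) := by
          simp only [Finset.mul_sum, Finset.sum_mul]
          rw [Finset.sum_comm]
          exact Finset.sum_congr rfl fun _ _ => Finset.sum_congr rfl fun _ _ => by ring
      _ = _ := by simp [hAB]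
  rw [this]
  -- Since `A * A⁻¹ = 1`, what remains is `(1 + 2 I * (I / 2)) ⟨∂_i · u⟩`.
  linear_combination (wickMean D A⁻¹ κ (divergence D i u)) * Complex.I_mul_I

end Mean

/-! ### The Gaussian exponent as the sum of the propagators. -/

namespace Propagators

variable {ι : Type} [Fintype ι] [DecidableEq ι] {P n : ℕ} (Φ : Propagators ι P n)

theorem momentum_dot (j : Fin P) (u : Vec ι n) : dot (Φ.momentum j) u
    = (∑ l, C (Φ.coeff j l : ℂ) * dot (loopVec l) u) + dot (constVec (Φ.shift j)) u := by
  rw [dot_eq_sum, constVec_dot]; rfl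

theorem dirDeriv_denom (ε : ℝ) (j : Fin P) (i : ι) (u : Vec ι n) :
    dirDeriv i u (Φ.denom ε j) = -2 * C (Φ.coeff j i : ℂ) * dot (Φ.momentum j) u := by
  have hs : ∀ {τ : Type} (s : Finset τ) (F : τ → Scalar ι n),
      dirDeriv i u (∑ x ∈ s, F x) = ∑ x ∈ s, dirDeriv i u (F x) := by
    intro τ s F
    induction s using Finset.cons_induction with
    | empty => simp [dirDeriv_zero]
    | cons a s ha ih => rw [Finset.sum_cons, Finset.sum_cons, dirDeriv_add, ih]
  have hd : dirDeriv i u (Φ.denom ε j)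
      = - dirDeriv i u (dot (Φ.momentum j) (Φ.momentum j)) := by
    have : Φ.denom ε j = C ((Φ.massSq j : ℂ) - Complex.I * ε)
      + C (-1) * dot (Φ.momentum j) (Φ.momentum j) := by
      rw [denom, C_neg, C_1]; ring
    rw [this, dirDeriv_add, dirDeriv_C, dirDeriv_mul, dirDeriv_C]
    simp
  have hcm : ∀ (c : ℂ) (f : Scalar ι n), dirDeriv i u (C c * f) = C c * dirDeriv i u f := by
    intro c f; rw [dirDeriv_mul, dirDeriv_C]; ring
  have hc : ∀ l, dirDeriv i u (dot (loopVec l) (Φ.momentum j))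
      = C (if i = l then 1 else 0) * dot (Φ.momentum j) u
        + C (Φ.coeff j i : ℂ) * dot (loopVec l) u := by
    intro l
    rw [dot_comm, momentum_dot, dirDeriv_add, hs, constVec_dot, hs]
    simp only [hcm, loopVec_dot_loopVec, basisVec_dot_loopVec, dirDeriv_X_inl, dirDeriv_X_inr,
      mul_add, Finset.sum_add_distrib]
    rw [momentum_dot, constVec_dot]
    have e1 : ∑ m, C (Φ.coeff j m : ℂ) * (C (if i = m then 1 else 0) * dot u (loopVec l))
        = C (Φ.coeff j i : ℂ) * dot (loopVec l) u := by
      rw [Finset.sum_eq_single i]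
      · simp [dot_comm]
      · intro a _ h; simp [Ne.symm h]
      · simp
    -- One metric factor comes from the product `e_μ · k_l` and one from the gradient of `k_l^μ`;
    -- their product is 1.
    have e2 : ∀ μ, C (Φ.shift j μ : ℂ) * (C (metric μ : ℂ) *
        (C ((if i = l then 1 else 0) * (metric μ : ℂ)) * dot u (basisVec μ)))
        = C (if i = l then 1 else 0) * (C (Φ.shift j μ : ℂ) * dot (basisVec μ) u) := by
      intro μ
      rw [C_mul, dot_comm u]
      linear_combination C (Φ.shift j μ : ℂ) * C (if i = l then 1 else 0) * dot (basisVec μ) u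
        * C_metric_mul_self (ι := ι) μ
    have e3 : ∀ m, C (Φ.coeff j m : ℂ) * (C (if i = l then 1 else 0) * dot u (loopVec m))
        = C (if i = l then 1 else 0) * (C (Φ.coeff j m : ℂ) * dot (loopVec m) u) := by
      intro m; rw [dot_comm u]; ring
    simp only [e1, e2, e3, ← Finset.mul_sum]
    ring
  have hp : ∀ x, dirDeriv i u (dot (constVec x) (Φ.momentum j))
      = C (Φ.coeff j i : ℂ) * dot (constVec x) u := by
    intro x
    rw [dot_comm, momentum_dot, dirDeriv_add, hs]
    have e : dot (constVec (Φ.shift j)) (constVec x : Vec ι n)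
        = C (∑ μ, (Φ.shift j μ : ℂ) * (metric μ * x μ)) := by
      rw [constVec_dot, map_sum]
      refine Finset.sum_congr rfl fun μ _ => ?_
      rw [basisVec_dot]; simp [constVec]
    rw [e, dirDeriv_C, add_zero, Finset.sum_eq_single i]
    · rw [hcm, dot_comm, constVec_dot, hs, constVec_dot]
      congr 1
      refine Finset.sum_congr rfl fun μ _ => ?_
      rw [hcm, basisVec_dot_loopVec, hcm, dirDeriv_X_inr, if_pos rfl, one_mul, dot_comm u]
      linear_combination C (x μ : ℂ) * dot (basisVec μ) u * C_metric_mul_self (ι := ι) μ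
    · intro a _ h
      rw [hcm, dot_comm, constVec_dot, hs]
      refine mul_eq_zero_of_right _ (Finset.sum_eq_zero fun μ _ => ?_)
      rw [hcm, basisVec_dot_loopVec, hcm, dirDeriv_X_inr, if_neg (Ne.symm h)]
      simp
    · simp
  rw [hd, momentum_dot, dirDeriv_add, hs, hp]
  simp only [hcm, hc, mul_add, Finset.sum_add_distrib]
  have e1 : ∑ l, C (Φ.coeff j l : ℂ) * (C (if i = l then 1 else 0) * dot (Φ.momentum j) u)
      = C (Φ.coeff j i : ℂ) * dot (Φ.momentum j) u := by
    rw [Finset.sum_eq_single i]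
    · simp
    · intro a _ h; simp [Ne.symm h]
    · simp
  have e2 : ∑ l, C (Φ.coeff j l : ℂ) * (C (Φ.coeff j i : ℂ) * dot (loopVec l) u)
      = C (Φ.coeff j i : ℂ) * ∑ l, C (Φ.coeff j l : ℂ) * dot (loopVec l) u := by
    rw [Finset.mul_sum]
    exact Finset.sum_congr rfl fun _ _ => by ring
  rw [e1, e2, momentum_dot]
  ring

omit [Fintype ι] [DecidableEq ι] in
theorem quadMatrix_isSymm (α : Fin P → ℝ) : (Φ.quadMatrix α).IsSymm := by
  ext l l'
  rw [Matrix.transpose_apply, quadMatrix, quadMatrix]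
  exact Finset.sum_congr rfl fun j _ => mul_right_comm _ _ _

/-- Since `b = -A κ`, the quadratic and linear terms combine into `A (k - κ)`. -/
theorem linVec_eq (α : Fin P → ℝ) (hdet : (Φ.quadMatrix α).det ≠ 0) (i : ι) (μ : Fin (n + 1)) :
    Φ.linVec α i μ = -∑ l, Φ.quadMatrix α i l * Φ.center α l μ := by
  have hAB : ∀ b, ∑ l, Φ.quadMatrix α i l * (Φ.quadMatrix α)⁻¹ l b = if i = b then 1 else 0 := by
    intro b
    have := congrFun (congrFun
      (Matrix.mul_nonsing_inv (Φ.quadMatrix α) (isUnit_iff_ne_zero.mpr hdet)) i) b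
    rwa [Matrix.mul_apply, Matrix.one_apply] at this
  simp only [center, Pi.neg_apply, Finset.sum_apply, Pi.smul_apply, smul_eq_mul, mul_neg,
    Finset.sum_neg_distrib, neg_neg, Finset.mul_sum, ← mul_assoc]
  rw [Finset.sum_comm]
  simp [← Finset.sum_mul, hAB]

/-- The Gaussian mean of the total derivative of `u exp(-i ∑_j α_j X_j)` vanishes. -/
theorem wickMean_total_derivative (ε : ℝ) (D : ℂ) (α : Fin P → ℝ)
    (hdet : (Φ.quadMatrix α).det ≠ 0) (i : ι) (u : Vec ι n) :
    wickMean D (Φ.quadMatrix α)⁻¹ (Φ.center α) (divergence D i u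
      - ∑ j, C (Complex.I * α j) * dirDeriv i u (Φ.denom ε j)) = 0 := by
  have h := wickMean_integration_by_parts D (Φ.quadMatrix_isSymm α) hdet (Φ.center α) i u
  have e1 : dot (constVec (Φ.linVec α i)) u
      = -∑ l, C (Φ.quadMatrix α i l : ℂ) * dot (constVec (Φ.center α l)) u := by
    have h1 := fun l => constVec_dot (Φ.center α l) u
    rw [constVec_dot]
    simp only [h1, Finset.mul_sum]
    rw [Finset.sum_comm, ← Finset.sum_neg_distrib]
    refine Finset.sum_congr rfl fun μ _ => ?_
    rw [Φ.linVec_eq α hdet i μ]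
    push_cast
    simp only [map_neg, map_sum, C_mul, neg_mul, Finset.sum_mul, mul_assoc]
  have e2 : dot (constVec (Φ.linVec α i)) u
      = ∑ j, C (α j * Φ.coeff j i : ℂ) * dot (constVec (Φ.shift j)) u := by
    have h1 := fun j => constVec_dot (Φ.shift j) u
    rw [constVec_dot]
    simp only [h1, Finset.mul_sum]
    rw [Finset.sum_comm]
    refine Finset.sum_congr rfl fun μ _ => ?_
    simp only [linVec, Finset.sum_apply, Pi.smul_apply, smul_eq_mul]
    push_cast
    simp only [map_sum, C_mul, Finset.sum_mul, mul_assoc]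
  have e3 : ∑ l, C (Φ.quadMatrix α i l : ℂ) * dot (loopVec l) u
      = ∑ j, C (α j * Φ.coeff j i : ℂ) * ∑ l, C (Φ.coeff j l : ℂ) * dot (loopVec l) u := by
    simp only [Finset.mul_sum]
    rw [Finset.sum_comm]
    refine Finset.sum_congr rfl fun l _ => ?_
    simp only [quadMatrix]
    push_cast
    simp only [map_sum, C_mul, Finset.sum_mul, mul_assoc]
  -- By `dirDeriv_denom` each summand is `2 I α_j a_ji q_j · u`, and `e1`, `e2`, `e3` give `∑_j α_j
  -- a_ji q_j = ∑_l A_il (k_l - κ_l)` inside the product with `u`.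
  convert h using 2
  simp only [mul_sub, Finset.sum_sub_distrib, dirDeriv_denom]
  have e4 : ∑ l, C (Φ.quadMatrix α i l : ℂ) * dot (constVec (Φ.center α l)) u
      = -∑ j, C (α j * Φ.coeff j i : ℂ) * dot (constVec (Φ.shift j)) u := by
    rw [← e2, e1, neg_neg]
  rw [e3, e4, sub_eq_add_neg, ← Finset.sum_neg_distrib]
  congr 1
  rw [mul_neg, sub_neg_eq_add, Finset.mul_sum, Finset.mul_sum, ← Finset.sum_add_distrib]
  refine Finset.sum_congr rfl fun j _ => ?_
  rw [momentum_dot]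
  simp only [C_mul, map_ofNat]
  ring

end Propagators

end DimReg

namespace DimReg

open MvPolynomial

/-! ### Polynomial growth up to poles in a determinant; `r` counts the order of the pole. -/

section PolyGrowth

variable {X : Type} [MeasurableSpace X] {ω δ : X → ℝ} {Ω : Set X}

/-- The function `g` is measurable, and `δ ^ r * g` grows at most like a power of `ω` on `Ω`. -/
def PolyGrowth (ω δ : X → ℝ) (Ω : Set X) (r : ℕ) (g : X → ℂ) : Prop :=
  Measurable g ∧ ∃ (c : ℝ) (K : ℕ), 0 ≤ c ∧ ∀ x ∈ Ω, |δ x| ^ r * ‖g x‖ ≤ c * ω x ^ K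

namespace PolyGrowth

theorem const (a : ℂ) : PolyGrowth ω δ Ω 0 fun _ => a :=
  ⟨measurable_const, ‖a‖, 0, norm_nonneg a, fun x _ => by simp⟩

theorem add (hω : ∀ x ∈ Ω, 1 ≤ ω x) {r : ℕ} {f g : X → ℂ} (hf : PolyGrowth ω δ Ω r f)
    (hg : PolyGrowth ω δ Ω r g) : PolyGrowth ω δ Ω r fun x => f x + g x := by
  obtain ⟨hf, c, K, hc, h⟩ := hf
  obtain ⟨hg, c', K', hc', h'⟩ := hg
  refine ⟨hf.add hg, c + c', max K K', by positivity, fun x hx => ?_⟩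
  calc |δ x| ^ r * ‖f x + g x‖ ≤ |δ x| ^ r * (‖f x‖ + ‖g x‖) := by gcongr; exact norm_add_le _ _
    _ = |δ x| ^ r * ‖f x‖ + |δ x| ^ r * ‖g x‖ := by ring
    _ ≤ c * ω x ^ K + c' * ω x ^ K' := add_le_add (h x hx) (h' x hx)
    _ ≤ c * ω x ^ (max K K') + c' * ω x ^ (max K K') := by
      have := hω x hx
      gcongr <;> first | exact this | exact le_max_left _ _ | exact le_max_right _ _
    _ = (c + c') * ω x ^ (max K K') := by ring

theorem mul {r s : ℕ} {f g : X → ℂ} (hf : PolyGrowth ω δ Ω r f)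
    (hg : PolyGrowth ω δ Ω s g) : PolyGrowth ω δ Ω (r + s) fun x => f x * g x := by
  obtain ⟨hf, c, K, hc, h⟩ := hf
  obtain ⟨hg, c', K', hc', h'⟩ := hg
  refine ⟨hf.mul hg, c * c', K + K', by positivity, fun x hx => ?_⟩
  calc |δ x| ^ (r + s) * ‖f x * g x‖ = (|δ x| ^ r * ‖f x‖) * (|δ x| ^ s * ‖g x‖) := by
        rw [norm_mul]; ring
    _ ≤ (c * ω x ^ K) * (c' * ω x ^ K') :=
      mul_le_mul (h x hx) (h' x hx) (by positivity) ((by positivity : (0:ℝ) ≤ _).trans (h x hx))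
    _ = c * c' * ω x ^ (K + K') := by ring

theorem const_mul (a : ℂ) {r : ℕ} {f : X → ℂ}
    (hf : PolyGrowth ω δ Ω r f) : PolyGrowth ω δ Ω r fun x => a * f x := by
  simpa using (const a).mul hf

/-- Extra powers of `δ` are harmless because `δ` itself grows polynomially. -/
theorem mono_right (hδ : PolyGrowth ω δ Ω 0 fun x => (δ x : ℂ))
    {r s : ℕ} (hrs : r ≤ s) {f : X → ℂ} (hf : PolyGrowth ω δ Ω r f) : PolyGrowth ω δ Ω s f := by
  obtain ⟨t, rfl⟩ := Nat.exists_eq_add_of_le hrs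
  clear hrs
  induction t with
  | zero => exact hf
  | succ t ih =>
    obtain ⟨-, c, K, hc, h⟩ := ih
    obtain ⟨-, c', K', hc', h'⟩ := hδ
    refine ⟨hf.1, c * c', K + K', by positivity, fun x hx => ?_⟩
    have h1 := h x hx
    have h2 := h' x hx
    simp only [pow_zero, one_mul, Complex.norm_real, Real.norm_eq_abs] at h2
    calc |δ x| ^ (r + (t + 1)) * ‖f x‖ = (|δ x| ^ (r + t) * ‖f x‖) * |δ x| := by ring
      _ ≤ (c * ω x ^ K) * (c' * ω x ^ K') :=
        mul_le_mul h1 h2 (by positivity) ((by positivity : (0:ℝ) ≤ _).trans h1)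
      _ = c * c' * ω x ^ (K + K') := by ring

theorem sum (hω : ∀ x ∈ Ω, 1 ≤ ω x) (hδ : PolyGrowth ω δ Ω 0 fun x => (δ x : ℂ)) {τ : Type}
    (s : Finset τ) {r : ℕ} {f : τ → X → ℂ} (hf : ∀ i ∈ s, PolyGrowth ω δ Ω r (f i)) :
    PolyGrowth ω δ Ω r fun x => ∑ i ∈ s, f i x := by
  induction s using Finset.cons_induction with
  | empty => simpa using mono_right hδ (Nat.zero_le r) (const 0)
  | cons a s ha ih =>
    simp only [Finset.sum_cons]
    exact (hf a (Finset.mem_cons_self a s)).add hω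
      (ih fun i hi => hf i (Finset.mem_cons_of_mem hi))

theorem prod {τ : Type} (s : Finset τ) {r : τ → ℕ} {f : τ → X → ℂ}
    (hf : ∀ i ∈ s, PolyGrowth ω δ Ω (r i) (f i)) :
    PolyGrowth ω δ Ω (∑ i ∈ s, r i) fun x => ∏ i ∈ s, f i x := by
  induction s using Finset.cons_induction with
  | empty => simpa using const 1
  | cons a s ha ih =>
    simp only [Finset.prod_cons, Finset.sum_cons]
    exact (hf a (Finset.mem_cons_self a s)).mul
      (ih fun i hi => hf i (Finset.mem_cons_of_mem hi))

theorem pow {r : ℕ} {f : X → ℂ} (hf : PolyGrowth ω δ Ω r f) (k : ℕ) :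
    PolyGrowth ω δ Ω (k * r) fun x => f x ^ k := by
  simpa using prod (Finset.range k) (r := fun _ => r) (f := fun _ => f) fun _ _ => hf

theorem det (hω : ∀ x ∈ Ω, 1 ≤ ω x) (hδ : PolyGrowth ω δ Ω 0 fun x => (δ x : ℂ)) {ι : Type}
    [Fintype ι] [DecidableEq ι] {M : X → Matrix ι ι ℝ}
    (hM : ∀ i j, PolyGrowth ω δ Ω 0 fun x => (M x i j : ℂ)) :
    PolyGrowth ω δ Ω 0 fun x => ((M x).det : ℂ) := by
  simp only [Matrix.det_apply']
  push_cast
  refine sum hω hδ _ fun σ _ => const_mul _ ?_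
  simpa using prod Finset.univ (r := fun _ => 0) (f := fun i x => (M x (σ i) i : ℂ))
    fun i _ => hM _ _

variable {ι : Type} [Fintype ι] [DecidableEq ι] {n : ℕ}

theorem inv (hω : ∀ x ∈ Ω, 1 ≤ ω x) {M : X → Matrix ι ι ℝ}
    (hδ : PolyGrowth ω (fun x => (M x).det) Ω 0 fun x => ((M x).det : ℂ))
    (hM : ∀ i j, PolyGrowth ω (fun x => (M x).det) Ω 0 fun x => (M x i j : ℂ)) (i j : ι) :
    PolyGrowth ω (fun x => (M x).det) Ω 1 fun x => ((M x)⁻¹ i j : ℂ) := by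
  have hadj : PolyGrowth ω (fun x => (M x).det) Ω 0 fun x => ((M x).adjugate i j : ℂ) := by
    simp only [Matrix.adjugate_apply]
    refine det hω hδ fun a b => ?_
    by_cases h : a = j
    · simp only [h, Matrix.updateRow_self]
      exact const _
    · simp only [Matrix.updateRow_ne h]
      exact hM a b
  have e : ∀ x, ((M x)⁻¹ i j : ℂ) = ((M x).det : ℂ)⁻¹ * ((M x).adjugate i j : ℂ) := by
    intro x
    rw [Matrix.inv_def, Ring.inverse_eq_inv', Matrix.smul_apply, smul_eq_mul]
    push_cast; rfl
  obtain ⟨hm, c, K, hc, h⟩ := hadj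
  simp only [e]
  refine ⟨hδ.1.inv.mul hm, c, K, hc, fun x hx => le_trans ?_ (h x hx)⟩
  rw [norm_mul, norm_inv, Complex.norm_real, Real.norm_eq_abs, pow_one, pow_zero, one_mul,
    ← mul_assoc]
  -- The bound `|δ| * |δ|⁻¹ ≤ 1` also holds at `δ = 0`, so singular matrices need no separate case.
  exact mul_le_of_le_one_left (norm_nonneg _) mul_inv_le_one

omit [Fintype ι] [DecidableEq ι] in
theorem evalAt (hω : ∀ x ∈ Ω, 1 ≤ ω x) (hδ : PolyGrowth ω δ Ω 0 fun x => (δ x : ℂ))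
    {κ : X → ι → Mink n} (hκ : ∀ l μ, PolyGrowth ω δ Ω 1 fun x => (κ x l μ : ℂ))
    (f : Scalar ι n) : PolyGrowth ω δ Ω (2 * f.totalDegree) fun x => evalAt (κ x) f := by
  have hv : ∀ v : ScalarVar ι n, PolyGrowth ω δ Ω 2 fun x =>
      DimReg.evalAt (κ x) (MvPolynomial.X v) := by
    rintro (z | ⟨l, μ⟩)
    · induction z using Sym2.ind with
      | _ l m =>
        simp only [DimReg.evalAt, eval_X, Sum.elim_inl, Sym2.lift_mk, mdot]
        push_cast
        refine sum hω hδ _ fun μ _ => ?_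
        exact (const_mul (metric μ : ℂ) (hκ l μ)).mul (hκ m μ)
    · simp only [DimReg.evalAt, eval_X, Sum.elim_inr]
      exact mono_right hδ one_le_two (hκ l μ)
  simp only [DimReg.evalAt, eval_X] at hv
  simp only [DimReg.evalAt, eval_eq]
  refine sum hω hδ _ fun m hm => const_mul _ ?_
  refine mono_right hδ ?_ (prod m.support fun v _ => pow (hv v) (m v))
  rw [← Finset.sum_mul, mul_comm]
  exact Nat.mul_le_mul_left 2 (le_totalDegree hm)

/-- Each contraction costs one factor of `B`, hence one power of `δ`; the final evaluation costs two
per variable, since `k_l · k_l'` is quadratic in `κ`. The contraction depends on `x`, so it is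
expanded into `laplace` operators that do not. -/
theorem contractedValue (hω : ∀ x ∈ Ω, 1 ≤ ω x) (hδ : PolyGrowth ω δ Ω 0 fun x => (δ x : ℂ))
    {κ : X → ι → Mink n} (hκ : ∀ l μ, PolyGrowth ω δ Ω 1 fun x => (κ x l μ : ℂ))
    {B : X → Matrix ι ι ℝ} (hB : ∀ i j, PolyGrowth ω δ Ω 1 fun x => (B x i j : ℂ)) (D : ℂ)
    (m d : ℕ) (f : Scalar ι n) (hf : f.totalDegree ≤ d) :
    PolyGrowth ω δ Ω (m + 2 * d) fun x => contractedValue D (B x) (κ x) m f := by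
  induction m generalizing f with
  | zero => exact mono_right hδ (by omega) (evalAt hω hδ hκ f)
  | succ m ih =>
    have e : ∀ x, contraction D (B x) f
        = ∑ l, ∑ l', C (B x l l' : ℂ) * laplace D l l' f := fun x => rfl
    simp only [contractedValue_succ, e, contractedValue_sum, contractedValue_C_mul]
    refine sum hω hδ _ fun l _ => sum hω hδ _ fun l' _ => ?_
    refine mono_right hδ ?_ ((hB l l').mul (ih (laplace D l l' f)
      ((totalDegree_laplace_le D l l' f).trans ((Nat.sub_le _ _).trans hf))))
    omega

/-- At most `d` contractions contribute, so the pole order is at most `d + 2 * d`. -/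
theorem wickMean (hω : ∀ x ∈ Ω, 1 ≤ ω x) (hδ : PolyGrowth ω δ Ω 0 fun x => (δ x : ℂ))
    {κ : X → ι → Mink n} (hκ : ∀ l μ, PolyGrowth ω δ Ω 1 fun x => (κ x l μ : ℂ))
    {B : X → Matrix ι ι ℝ} (hB : ∀ i j, PolyGrowth ω δ Ω 1 fun x => (B x i j : ℂ)) (D : ℂ)
    (d : ℕ) (f : Scalar ι n) (hf : f.totalDegree ≤ d) :
    PolyGrowth ω δ Ω (3 * d) fun x => wickMean D (B x) (κ x) f := by
  simp only [DimReg.wickMean]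
  refine sum hω hδ _ fun m hm => const_mul _ ?_
  rw [Finset.mem_range] at hm
  exact mono_right hδ (by omega) (contractedValue hω hδ hκ hB D m d f hf)

theorem cpow_mul (hω : ∀ x ∈ Ω, 1 ≤ ω x) (hδ : PolyGrowth ω δ Ω 0 fun x => (δ x : ℂ))
    {r : ℕ} {g : X → ℂ} (hg : PolyGrowth ω δ Ω r g) {z : ℂ} (hz : r ≤ z.re) :
    PolyGrowth ω δ Ω 0 fun x => (δ x : ℂ) ^ z * g x := by
  obtain ⟨hm, c, K, hc, h⟩ := hg
  obtain ⟨hm', c', K', hc', h'⟩ := hδ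
  -- After the pole is cancelled, `|δ| ^ (z.re - r)` is left; a base of at least 1, secured by `1 +
  -- c'`, permits rounding the exponent up. The exponential bounds `exp (-arg δ * z.im)` without
  -- using the sign of `δ`.
  set N := ⌈z.re - r⌉₊
  refine ⟨(hm'.pow_const z).mul hm, Real.exp (Real.pi * |z.im|) * (1 + c') ^ N * c, K' * N + K,
    by positivity, fun x hx => ?_⟩
  have h2 := h' x hx
  have hω1 := hω x hx
  simp only [pow_zero, one_mul, Complex.norm_real, Real.norm_eq_abs] at h2
  have h3 : |δ x| ^ (z.re - r) ≤ ((1 + c') * ω x ^ K') ^ N := by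
    have hb : 1 ≤ (1 + c') * ω x ^ K' := by
      have : 1 ≤ ω x ^ K' := one_le_pow₀ hω1
      nlinarith
    have hle : |δ x| ≤ (1 + c') * ω x ^ K' := by
      have : 0 ≤ ω x ^ K' := by positivity
      linarith
    calc |δ x| ^ (z.re - r) ≤ ((1 + c') * ω x ^ K') ^ (z.re - r) :=
          Real.rpow_le_rpow (abs_nonneg _) hle (by linarith)
      _ ≤ ((1 + c') * ω x ^ K') ^ (N : ℝ) := Real.rpow_le_rpow_of_exponent_le hb (Nat.le_ceil _)
      _ = _ := Real.rpow_natCast _ _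
  have h4 : ‖(δ x : ℂ) ^ z‖ ≤ Real.exp (Real.pi * |z.im|) * (|δ x| ^ (z.re - r) * |δ x| ^ r) := by
    have e : |δ x| ^ (z.re - r) * |δ x| ^ r = |δ x| ^ z.re := by
      rw [← Real.rpow_natCast |δ x| r, ← Real.rpow_add_of_nonneg (abs_nonneg _) (by linarith)
        (Nat.cast_nonneg r), sub_add_cancel]
    rw [e]
    refine (Complex.norm_cpow_le _ _).trans ?_
    rw [Complex.norm_real, Real.norm_eq_abs, div_eq_mul_inv, ← Real.exp_neg, mul_comm]
    refine mul_le_mul_of_nonneg_right (Real.exp_le_exp.mpr ?_) (by positivity)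
    calc -(Complex.arg (δ x) * z.im) ≤ |Complex.arg (δ x) * z.im| := neg_le_abs _
      _ = |Complex.arg (δ x)| * |z.im| := abs_mul _ _
      _ ≤ Real.pi * |z.im| := by gcongr; exact Complex.abs_arg_le_pi _
  calc |δ x| ^ 0 * ‖(δ x : ℂ) ^ z * g x‖ = ‖(δ x : ℂ) ^ z‖ * ‖g x‖ := by
        rw [pow_zero, one_mul, norm_mul]
    _ ≤ Real.exp (Real.pi * |z.im|) * (|δ x| ^ (z.re - r) * |δ x| ^ r) * ‖g x‖ := by gcongr
    _ = Real.exp (Real.pi * |z.im|) * |δ x| ^ (z.re - r) * (|δ x| ^ r * ‖g x‖) := by ring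
    _ ≤ Real.exp (Real.pi * |z.im|) * ((1 + c') * ω x ^ K') ^ N * (c * ω x ^ K) := by
      refine mul_le_mul (by gcongr) (h x hx) (by positivity) (by positivity)
    _ = _ := by rw [mul_pow, ← pow_mul, pow_add]; ring

end PolyGrowth

end PolyGrowth

/-! ### Convergence of the parametric integrals. -/

section Parameters

open MeasureTheory

theorem integrableOn_prod_one_add_pow_mul_exp {J : Type} [Fintype J] (K : ℕ) {ε : ℝ}
    (hε : 0 < ε) : IntegrableOn
      (fun α : J → ℝ => (∏ j, (1 + α j)) ^ K * Real.exp (-(ε * ∑ j, α j))) {α | ∀ j, 0 < α j} := by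
  have h1 : IntegrableOn (fun x : ℝ => (1 + x) ^ K * Real.exp (-(ε * x))) (Set.Ioi 0) := by
    refine integrable_of_isBigO_exp_neg (half_pos hε) (by fun_prop) ?_
    have h := (isLittleO_pow_exp_pos_mul_atTop K (half_pos hε)).comp_tendsto
      (Filter.tendsto_atTop_add_const_left Filter.atTop (1 : ℝ) Filter.tendsto_id)
    have h2 := h.isBigO.mul (Asymptotics.isBigO_refl (fun x : ℝ => Real.exp (-(ε * x)))
      Filter.atTop)
    refine h2.trans ?_
    -- Half of the decay absorbs the power; the constant comes from the shift `1 + x` in `exp (ε / 2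
    -- * (1 + x))`.
    refine Asymptotics.IsBigO.of_bound (Real.exp (ε / 2)) (Filter.Eventually.of_forall fun x => ?_)
    simp only [Function.comp, id, ← Real.exp_add, Real.norm_eq_abs, Real.abs_exp]
    exact (Real.exp_le_exp.mpr (by ring_nf; rfl)).trans le_rfl
  have h2 := Integrable.fintype_prod (𝕜 := ℝ) (ι := J) (E := ℝ)
    (f := fun _ (x : ℝ) => (1 + x) ^ K * Real.exp (-(ε * x)))
    (μ := fun _ => (volume : Measure ℝ).restrict (Set.Ioi 0)) (fun _ => h1)
  rw [← Measure.restrict_pi_pi] at h2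
  have e : {α : J → ℝ | ∀ j, 0 < α j} = Set.univ.pi fun _ => Set.Ioi 0 := by
    ext; simp
  rw [IntegrableOn, e, volume_pi]
  refine h2.congr (Filter.Eventually.of_forall fun α => ?_)
  simp only [Finset.prod_mul_distrib, Finset.prod_pow, ← Real.exp_sum, Finset.sum_neg_distrib,
    Finset.mul_sum]

theorem measurableSet_pos {J : Type} [Fintype J] : MeasurableSet {α : J → ℝ | ∀ j, 0 < α j} := by
  have e : {α : J → ℝ | ∀ j, 0 < α j} = Set.univ.pi fun _ => Set.Ioi 0 := by
    ext; simp
  rw [e]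
  exact MeasurableSet.univ_pi fun _ => measurableSet_Ioi

end Parameters

namespace Propagators

open MeasureTheory

variable {ι : Type} [Fintype ι] [DecidableEq ι] {P n : ℕ} (Φ : Propagators ι P n)

/-- The numerator of `N / ∏_j X_j^{ν_j}` including the factors with `ν_j ≤ 0`. -/
def fullNumerator (ε : ℝ) (ν : Fin P → ℤ) (N : Scalar ι n) : Scalar ι n :=
  N * ∏ j, if 0 < ν j then 1 else Φ.denom ε j ^ (-ν j).toNat

/-- The condition on `D` is `Re (-D / 2) ≥ 3 * d`, the pole order of the mean. As `ν j ≥ 1` for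
every parameter, the weights are polynomial and cause no divergence at `α = 0`. -/
theorem integrableOn_schwinger {ε : ℝ} (hε : 0 < ε) (ν : Fin P → ℤ) (d : ℕ) {D : ℂ}
    {N : Scalar ι n} (hN : (Φ.fullNumerator ε ν N).totalDegree ≤ d) (hD : D.re ≤ -(6 * d)) :
    IntegrableOn (Φ.schwinger ε D ν N) {α | ∀ j, 0 < α j} := by
  set Ω : Set ({j : Fin P // 0 < ν j} → ℝ) := {α | ∀ j, 0 < α j} with hΩ
  set ω : ({j : Fin P // 0 < ν j} → ℝ) → ℝ := fun α => ∏ j, (1 + α j) with hωdef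
  set β : ({j : Fin P // 0 < ν j} → ℝ) → Fin P → ℝ :=
    fun α j => if h : 0 < ν j then α ⟨j, h⟩ else 0 with hβ
  have hω : ∀ α ∈ Ω, 1 ≤ ω α := fun α hα =>
    Finset.one_le_prod fun j _ => by linarith [hα j]
  have hα : ∀ δ j, PolyGrowth ω δ Ω 0 fun α => (α j : ℂ) := by
    intro δ j
    refine ⟨by fun_prop, 1, 1, zero_le_one, fun α hα => ?_⟩
    rw [pow_zero, one_mul, one_mul, pow_one, Complex.norm_real, Real.norm_eq_abs,
      abs_of_pos (hα j)]
    have h1 : 1 + α j ≤ ω α := by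
      rw [hωdef]
      simp only
      rw [← Finset.mul_prod_erase Finset.univ _ (Finset.mem_univ j)]
      refine le_mul_of_one_le_right (by linarith [hα j]) ?_
      exact Finset.one_le_prod fun k _ => by linarith [hα k]
    linarith
  have hβg : ∀ δ j, PolyGrowth ω δ Ω 0 fun α => (β α j : ℂ) := by
    intro δ j
    by_cases h : 0 < ν j
    · simp only [hβ, dif_pos h]; exact hα δ ⟨j, h⟩
    · simp only [hβ, dif_neg h]; exact PolyGrowth.const _
  -- For `r = 0` the notion does not involve `δ`. Taking `δ = 0` first gives the growth of the
  -- determinant, which then serves as `δ`.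
  have h0 : PolyGrowth ω 0 Ω 0 fun α => ((0 : ({j : Fin P // 0 < ν j} → ℝ) → ℝ) α : ℂ) := by
    simpa using PolyGrowth.const (ω := ω) (δ := 0) (Ω := Ω) 0
  have hA0 : ∀ l l', PolyGrowth ω 0 Ω 0 fun α => (Φ.quadMatrix (β α) l l' : ℂ) := by
    intro l l'
    simp only [quadMatrix]
    push_cast
    refine PolyGrowth.sum hω h0 _ fun j _ => ?_
    exact ((hβg 0 j).mul (PolyGrowth.const _)).mul (PolyGrowth.const _)
  set δ : ({j : Fin P // 0 < ν j} → ℝ) → ℝ := fun α => (Φ.quadMatrix (β α)).det with hδdef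
  have hconv : ∀ {g : ({j : Fin P // 0 < ν j} → ℝ) → ℂ}, PolyGrowth ω 0 Ω 0 g →
      PolyGrowth ω δ Ω 0 g := fun h => h
  have hA : ∀ l l', PolyGrowth ω δ Ω 0 fun α => (Φ.quadMatrix (β α) l l' : ℂ) :=
    fun l l' => hconv (hA0 l l')
  have hδ : PolyGrowth ω δ Ω 0 fun α => (δ α : ℂ) := hconv (PolyGrowth.det hω h0 hA0)
  have hB := PolyGrowth.inv hω hδ hA
  have hb : ∀ l μ, PolyGrowth ω δ Ω 0 fun α => (Φ.linVec (β α) l μ : ℂ) := by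
    intro l μ
    simp only [linVec, Finset.sum_apply, Pi.smul_apply, smul_eq_mul]
    push_cast
    refine PolyGrowth.sum hω hδ _ fun j _ => ?_
    exact ((hβg δ j).mul (PolyGrowth.const _)).mul (PolyGrowth.const _)
  have hκ : ∀ l μ, PolyGrowth ω δ Ω 1 fun α => (Φ.center (β α) l μ : ℂ) := by
    intro l μ
    have e : ∀ α, (Φ.center (β α) l μ : ℂ) = (-1) * ∑ l', ((Φ.quadMatrix (β α))⁻¹ l l' : ℂ) *
        (Φ.linVec (β α) l' μ : ℂ) := by
      intro α
      simp only [center, Pi.neg_apply, Finset.sum_apply, Pi.smul_apply, smul_eq_mul]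
      push_cast; ring
    simp only [e]
    exact PolyGrowth.const_mul _ (PolyGrowth.sum hω hδ _ fun l' _ => (hB l l').mul (hb l' μ))
  have hW := PolyGrowth.cpow_mul hω hδ (z := -D / 2)
    (PolyGrowth.wickMean hω hδ hκ hB D d _ hN) (by
      have : (-D / 2).re = -D.re / 2 := by simp
      rw [this]; push_cast; linarith)
  have hw : PolyGrowth ω δ Ω 0 fun α : {j : Fin P // 0 < ν j} → ℝ =>
      ∏ j, Complex.I ^ ν j.1 * (α j : ℂ) ^ (ν j.1 - 1) / Complex.Gamma (ν j.1 : ℂ) := by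
    have := PolyGrowth.prod (ω := ω) (δ := δ) (Ω := Ω) (Finset.univ : Finset {j : Fin P // 0 < ν j})
      (r := fun _ => 0)
      (f := fun j α => Complex.I ^ ν j.1 * (α j : ℂ) ^ (ν j.1 - 1) / Complex.Gamma (ν j.1 : ℂ))
      fun j _ => by
        have e : ν j.1 - 1 = ((ν j.1 - 1).toNat : ℤ) := by have := j.2; omega
        simp only [div_eq_mul_inv]
        rw [e]
        simp only [zpow_natCast]
        exact ((PolyGrowth.pow (hα δ j) _).const_mul _).mul (PolyGrowth.const _)
    simpa using this
  have hmd : ∀ l l', PolyGrowth ω δ Ω 1 fun α => (((Φ.quadMatrix (β α))⁻¹ l l' *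
      mdot (Φ.linVec (β α) l) (Φ.linVec (β α) l') : ℝ) : ℂ) := by
    intro l l'
    simp only [mdot]
    push_cast
    exact (hB l l').mul (s := 0) (PolyGrowth.sum hω hδ _ fun μ _ =>
      ((hb l μ).const_mul _).mul (hb l' μ))
  set E : ({j : Fin P // 0 < ν j} → ℝ) → ℂ := fun α =>
    -Complex.I * (∑ j, (β α j : ℂ) *
          ((Φ.massSq j : ℂ) - mdot (Φ.shift j) (Φ.shift j) - Complex.I * ε))
        - Complex.I * ((∑ l, ∑ l', (Φ.quadMatrix (β α))⁻¹ l l' *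
            mdot (Φ.linVec (β α) l) (Φ.linVec (β α) l') : ℝ) : ℂ) with hE
  have hEm : Measurable E := by
    simp only [hE, Complex.ofReal_sum]
    exact ((Finset.measurable_fun_sum _ fun j _ => (hβg δ j).1.mul_const _).const_mul _).sub
      ((Finset.measurable_fun_sum _ fun l _ => Finset.measurable_fun_sum _ fun l' _ =>
        (hmd l l').1).const_mul _)
  -- Apart from the `ε` term the exponent is `I` times a real number, so singularities of `A⁻¹` in
  -- it only affect the phase.
  have hEre : ∀ α, (E α).re = -(ε * ∑ j, α j) := by
    intro α
    have e1 : (∑ j, β α j) = ∑ j, α j := by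
      simp only [hβ]
      rw [← Fintype.sum_subtype_add_sum_subtype (fun j => 0 < ν j)]
      have h1 : ∀ j : {j : Fin P // 0 < ν j}, (if h : 0 < ν j.1 then α ⟨j.1, h⟩ else 0) = α j :=
        fun j => dif_pos j.2
      have h2 : ∀ j : {j : Fin P // ¬ 0 < ν j}, (if h : 0 < ν j.1 then α ⟨j.1, h⟩ else 0) = 0 :=
        fun j => dif_neg j.2
      simp only [h1, h2, Finset.sum_const_zero, add_zero]
    have e2 : E α = ((-(ε * ∑ j, α j) : ℝ) : ℂ) + ((-(∑ j, β α j *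
        (Φ.massSq j - mdot (Φ.shift j) (Φ.shift j))) - ∑ l, ∑ l', ((Φ.quadMatrix (β α))⁻¹ l l' *
            mdot (Φ.linVec (β α) l) (Φ.linVec (β α) l')) : ℝ) : ℂ) * Complex.I := by
      have h3 : ∑ j, (β α j : ℂ) *
          ((Φ.massSq j : ℂ) - mdot (Φ.shift j) (Φ.shift j) - Complex.I * ε)
          = ((∑ j, β α j * (Φ.massSq j - mdot (Φ.shift j) (Φ.shift j)) : ℝ) : ℂ)
            - Complex.I * (ε * (∑ j, β α j : ℝ) : ℂ) := by
        push_cast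
        simp only [Finset.mul_sum, ← Finset.sum_sub_distrib]
        exact Finset.sum_congr rfl fun j _ => by ring
      simp only [hE]
      rw [h3, e1]
      push_cast
      linear_combination (ε * ∑ j, (α j : ℂ)) * Complex.I_mul_I
    rw [e2, Complex.add_re, Complex.ofReal_re, Complex.re_ofReal_mul, Complex.I_re, mul_zero,
      add_zero]
  have hall := hw.mul hW
  obtain ⟨-, c, K, hc, hbound⟩ := hall
  set G : ℂ := (Complex.I * (Real.pi : ℂ) ^ (D / 2) *
    Complex.exp (-(Real.pi * Complex.I * D / 4))) ^ Fintype.card ι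
  have heq : ∀ α, Φ.schwinger ε D ν N α = G * ((∏ j, Complex.I ^ ν j.1 *
      (α j : ℂ) ^ (ν j.1 - 1) / Complex.Gamma (ν j.1 : ℂ)) * ((δ α : ℂ) ^ (-D / 2) *
      wickMean D (Φ.quadMatrix (β α))⁻¹ (Φ.center (β α)) (Φ.fullNumerator ε ν N)))
      * Complex.exp (E α) := by
    intro α
    change _ * (G * (δ α : ℂ) ^ (-D / 2) * Complex.exp (E α) * wickMean D
      (Φ.quadMatrix (β α))⁻¹ (Φ.center (β α)) (Φ.fullNumerator ε ν N)) = _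
    ring
  refine ((integrableOn_prod_one_add_pow_mul_exp K hε).const_mul (‖G‖ * c)).mono' ?_ ?_
  · refine Measurable.aestronglyMeasurable ?_
    have : Φ.schwinger ε D ν N = _ := funext heq
    rw [this]
    exact ((hw.1.mul hW.1).const_mul G).mul hEm.cexp
  · refine (ae_restrict_iff' measurableSet_pos).mpr (Filter.Eventually.of_forall fun α hα => ?_)
    have h := hbound α hα
    rw [pow_zero, one_mul] at h
    rw [heq, norm_mul, norm_mul, Complex.norm_exp, hEre, mul_assoc ‖G‖, mul_assoc ‖G‖,
      ← mul_assoc c]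
    gcongr

end Propagators

end DimReg

/-! ### Collecting the terms of the total derivative; degree bounds uniform in `D`. -/

namespace DimReg

open MvPolynomial MeasureTheory

/-- With distinct keys no terms merge. This applies because the exponents `ν` and `ν + Pi.single j
1` are pairwise distinct. -/
theorem finsupp_sum_sum_single {τ κ M R : Type} [Fintype τ] [DecidableEq κ] [AddCommMonoid M]
    [AddCommMonoid R] {key : τ → κ} (hkey : Function.Injective key) (val : τ → M) (h : κ → M → R)
    (h0 : ∀ k, h k 0 = 0) :
    (∑ o, Finsupp.single (key o) (val o)).sum h = ∑ o, h (key o) (val o) := by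
  classical
  have hval : ∀ o, (∑ o, Finsupp.single (key o) (val o)) (key o) = val o := by
    intro o
    rw [Finsupp.finsetSum_apply, Finset.sum_eq_single o]
    · simp
    · intro b _ hb
      rw [Finsupp.single_eq_of_ne (fun e => hb (hkey e).symm)]
    · simp
  rw [Finsupp.sum_of_support_subset (s := Finset.univ.image key) _ _ _ fun k _ => h0 k,
    Finset.sum_image fun _ _ _ _ e => hkey e]
  · simp only [hval]
  · intro k hk
    by_contra hn
    rw [Finsupp.mem_support_iff, Finsupp.finsetSum_apply] at hk
    refine hk (Finset.sum_eq_zero fun o _ => Finsupp.single_eq_of_ne fun e => hn ?_)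
    exact Finset.mem_image.mpr ⟨o, Finset.mem_univ o, e.symm⟩

theorem mem_support_sum_single {τ κ M : Type} [Fintype τ] [AddCommMonoid M] {key : τ → κ}
    (hkey : Function.Injective key) (val : τ → M) {k : κ}
    (hk : k ∈ (∑ o, Finsupp.single (key o) (val o)).support) :
    ∃ o, k = key o ∧ (∑ o, Finsupp.single (key o) (val o)) k = val o := by
  classical
  by_cases h : ∃ o, k = key o
  · obtain ⟨o, rfl⟩ := h
    refine ⟨o, rfl, ?_⟩
    rw [Finsupp.finsetSum_apply, Finset.sum_eq_single o]
    · simp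
    · intro b _ hb
      rw [Finsupp.single_eq_of_ne (fun e => hb (hkey e).symm)]
    · simp
  · rw [Finsupp.mem_support_iff, Finsupp.finsetSum_apply] at hk
    exact absurd (Finset.sum_eq_zero fun o _ =>
      Finsupp.single_eq_of_ne fun e => h ⟨o, e⟩) hk

section UniformDegree

variable {ι : Type} {n : ℕ}

/-- The total degree of `f D` is bounded uniformly in `D`. -/
def UniformDegree (f : ℂ → Scalar ι n) : Prop := ∃ d, ∀ D, (f D).totalDegree ≤ d

namespace UniformDegree

theorem const (f : Scalar ι n) : UniformDegree fun _ => f := ⟨f.totalDegree, fun _ => le_rfl⟩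

theorem add {f g : ℂ → Scalar ι n} (hf : UniformDegree f) (hg : UniformDegree g) :
    UniformDegree fun D => f D + g D := by
  obtain ⟨a, ha⟩ := hf
  obtain ⟨b, hb⟩ := hg
  exact ⟨max a b, fun D => totalDegree_add_le_of_le ((ha D).trans (le_max_left _ _))
    ((hb D).trans (le_max_right _ _))⟩

theorem mul {f g : ℂ → Scalar ι n} (hf : UniformDegree f) (hg : UniformDegree g) :
    UniformDegree fun D => f D * g D := by
  obtain ⟨a, ha⟩ := hf
  obtain ⟨b, hb⟩ := hg
  exact ⟨a + b, fun D => totalDegree_mul_le_of_le (ha D) (hb D)⟩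

theorem neg {f : ℂ → Scalar ι n} (hf : UniformDegree f) : UniformDegree fun D => -f D := by
  simpa [UniformDegree] using hf

theorem sum {τ : Type} (s : Finset τ) {f : τ → ℂ → Scalar ι n}
    (hf : ∀ x ∈ s, UniformDegree (f x)) : UniformDegree fun D => ∑ x ∈ s, f x D := by
  induction s using Finset.cons_induction with
  | empty => simpa using const 0
  | cons a s ha ih =>
    simp only [Finset.sum_cons]
    exact (hf a (Finset.mem_cons_self a s)).add
      (ih fun i hi => hf i (Finset.mem_cons_of_mem hi))

variable [Fintype ι] [DecidableEq ι]

theorem dirDeriv (i : ι) (v : Vec ι n) {f : ℂ → Scalar ι n} (hf : UniformDegree f) :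
    UniformDegree fun D => dirDeriv i v (f D) := by
  obtain ⟨d, hd⟩ := hf
  simp only [dirDeriv_eq_sum i v]
  refine (sum _ fun l _ => (const (v.loop l)).mul ⟨d, fun D => ?_⟩).add
    (sum _ fun μ _ => (const (v.par μ)).mul ⟨d, fun D => ?_⟩)
  · exact (totalDegree_dirDeriv_loopVec_le i l _).trans (hd D)
  · exact (totalDegree_dirDeriv_basisVec_le i μ _).trans (hd D)

theorem divergence (i : ι) (v : Vec ι n) : UniformDegree fun D => divergence D i v := by
  refine ⟨max (Finset.univ.sup fun l => (v.loop l).totalDegree)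
    (Finset.univ.sup fun μ => (v.par μ).totalDegree), fun D => totalDegree_divergence_le D i
      (fun l => le_max_of_le_left ?_) (fun μ => le_max_of_le_right ?_)⟩
  · exact Finset.le_sup (f := fun l => (v.loop l).totalDegree) (Finset.mem_univ l)
  · exact Finset.le_sup (f := fun μ => (v.par μ).totalDegree) (Finset.mem_univ μ)

end UniformDegree

end UniformDegree

/-! ### Pointwise cancellation of the Schwinger integrands. -/

namespace Propagators

variable {ι : Type} [Fintype ι] [DecidableEq ι] {P n : ℕ} (Φ : Propagators ι P n)

/-- Extension by zero of the Schwinger parameters with index in `p`. -/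
def extendZero (p : Fin P → Prop) [DecidablePred p] (α : {j // p j} → ℝ) (j : Fin P) : ℝ :=
  if h : p j then α ⟨j, h⟩ else 0

/-- The factors of the Gaussian integral that do not depend on the integrand. -/
def gaussFactor (ε : ℝ) (D : ℂ) (α : Fin P → ℝ) : ℂ :=
  (Complex.I * (Real.pi : ℂ) ^ (D / 2) * Complex.exp (-(Real.pi * Complex.I * D / 4)))
      ^ Fintype.card ι
    * ((Φ.quadMatrix α).det : ℂ) ^ (-D / 2)
    * Complex.exp (-Complex.I * (∑ j, (α j : ℂ) *
          ((Φ.massSq j : ℂ) - mdot (Φ.shift j) (Φ.shift j) - Complex.I * ε))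
        - Complex.I * ∑ l, ∑ l',
          ((Φ.quadMatrix α)⁻¹ l l' * mdot (Φ.linVec α l) (Φ.linVec α l') : ℝ))

/-- The weight of the Schwinger parameters with index in `p`. -/
def schwingerWeight (p : Fin P → Prop) [DecidablePred p] (ν : Fin P → ℤ) (α : {j // p j} → ℝ) :
    ℂ :=
  ∏ j, Complex.I ^ ν j.1 * (α j : ℂ) ^ (ν j.1 - 1) / Complex.Gamma (ν j.1 : ℂ)

/-- The Schwinger parametric integrand with parameters for the indices in `p`. -/
def schwingerOn (p : Fin P → Prop) [DecidablePred p] (ε : ℝ) (D : ℂ) (ν : Fin P → ℤ)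
    (f : Scalar ι n) (α : {j // p j} → ℝ) : ℂ :=
  schwingerWeight p ν α * (Φ.gaussFactor ε D (extendZero p α) *
    wickMean D (Φ.quadMatrix (extendZero p α))⁻¹ (Φ.center (extendZero p α)) f)

theorem schwinger_eq (ε : ℝ) (D : ℂ) (ν : Fin P → ℤ) (N : Scalar ι n) :
    Φ.schwinger ε D ν N = Φ.schwingerOn (fun j => 0 < ν j) ε D ν (Φ.fullNumerator ε ν N) := rfl

theorem schwingerOn_zero (p : Fin P → Prop) [DecidablePred p] (ε : ℝ) (D : ℂ) (ν : Fin P → ℤ) :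
    Φ.schwingerOn p ε D ν 0 = 0 := by
  funext α
  simp [schwingerOn, wickMean_zero]

theorem schwinger_zero (ε : ℝ) (D : ℂ) (ν : Fin P → ℤ) : Φ.schwinger ε D ν 0 = 0 := by
  rw [schwinger_eq, fullNumerator, zero_mul, schwingerOn_zero]

/-- Integrals for different exponents live over different parameter types. This identifies them when
the same exponents are positive. -/
theorem schwingerOn_congr {p q : Fin P → Prop} [DecidablePred p] [DecidablePred q]
    (h : ∀ j, p j ↔ q j) (ε : ℝ) (D : ℂ) (ν : Fin P → ℤ) (f : Scalar ι n) :
    (∫ α in {α : {j // p j} → ℝ | ∀ j, 0 < α j}, Φ.schwingerOn p ε D ν f α)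
      = (∫ α in {α : {j // q j} → ℝ | ∀ j, 0 < α j}, Φ.schwingerOn q ε D ν f α) ∧
    (IntegrableOn (Φ.schwingerOn p ε D ν f) {α | ∀ j, 0 < α j} →
      IntegrableOn (Φ.schwingerOn q ε D ν f) {α | ∀ j, 0 < α j}) := by
  have e : p = q := funext fun j => propext (h j)
  subst e
  rename_i i1 i2
  have e : i1 = i2 := Subsingleton.elim _ _
  subst e
  exact ⟨rfl, id⟩

theorem dirDeriv_prod (i : ι) (v : Vec ι n) {τ : Type} [DecidableEq τ] (s : Finset τ)
    (F : τ → Scalar ι n) : dirDeriv i v (∏ x ∈ s, F x)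
      = ∑ x ∈ s, (∏ y ∈ s.erase x, F y) * dirDeriv i v (F x) := by
  induction s using Finset.cons_induction with
  | empty => simpa using dirDeriv_C i v 1
  | cons a s ha ih =>
    rw [Finset.prod_cons, dirDeriv_mul, ih, Finset.sum_cons, Finset.cons_eq_insert,
      Finset.erase_insert ha, Finset.mul_sum, add_comm]
    congr 1
    refine Finset.sum_congr rfl fun x hx => ?_
    have : a ≠ x := fun e => ha (e ▸ hx)
    rw [Finset.erase_insert_of_ne this, Finset.prod_insert (fun h => ha (Finset.mem_of_mem_erase h))]
    ring

theorem dirDeriv_pow (i : ι) (v : Vec ι n) (f : Scalar ι n) (k : ℕ) :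
    dirDeriv i v (f ^ k) = k * f ^ (k - 1) * dirDeriv i v f := by
  induction k with
  | zero => simpa using dirDeriv_C i v 1
  | succ k ih =>
    rw [pow_succ, dirDeriv_mul, ih]
    rcases k with _ | k
    · simp
    · simp only [Nat.add_sub_cancel]
      push_cast; ring

/-- The factor of the full numerator for the index `j`. -/
def numeratorFactor (ε : ℝ) (ν : Fin P → ℤ) (j : Fin P) : Scalar ι n :=
  if 0 < ν j then 1 else Φ.denom ε j ^ (-ν j).toNat

omit [DecidableEq ι] in
theorem fullNumerator_eq (ε : ℝ) (ν : Fin P → ℤ) (N : Scalar ι n) :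
    Φ.fullNumerator ε ν N = N * ∏ j, Φ.numeratorFactor ε ν j := rfl

omit [DecidableEq ι] in
theorem numeratorFactor_of_ne (ε : ℝ) (ν : Fin P → ℤ) {j k : Fin P} (h : k ≠ j) :
    Φ.numeratorFactor ε (ν + Pi.single j 1) k = Φ.numeratorFactor ε ν k := by
  simp [numeratorFactor, Pi.single_eq_of_ne h]

omit [DecidableEq ι] in
theorem fullNumerator_add_single_of_pos (ε : ℝ) {ν : Fin P → ℤ} {j : Fin P} (h : 0 < ν j)
    (N : Scalar ι n) : Φ.fullNumerator ε (ν + Pi.single j 1) N = Φ.fullNumerator ε ν N := by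
  rw [fullNumerator_eq, fullNumerator_eq]
  congr 1
  refine Finset.prod_congr rfl fun k _ => ?_
  by_cases e : k = j
  · subst e
    have : 0 < ν k + 1 := by omega
    simp [numeratorFactor, h, this]
  · exact Φ.numeratorFactor_of_ne ε ν e

/-- For `ν j < 0` the term is the ordinary derivative of the power `X_j^{-ν_j}` in the numerator. -/
theorem fullNumerator_add_single_of_neg (ε : ℝ) {ν : Fin P → ℤ} {j : Fin P} (h : ν j < 0)
    (i : ι) (v : Vec ι n) (N : Scalar ι n) : Φ.fullNumerator ε (ν + Pi.single j 1)
        (-(C (ν j : ℂ) * N * dirDeriv i v (Φ.denom ε j)))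
      = N * ((∏ k ∈ Finset.univ.erase j, Φ.numeratorFactor ε ν k)
        * dirDeriv i v (Φ.numeratorFactor ε ν j)) := by
  obtain ⟨m, hm⟩ : ∃ m : ℕ, ν j = -((m : ℤ) + 1) := ⟨(-ν j - 1).toNat, by omega⟩
  rw [fullNumerator_eq, ← Finset.mul_prod_erase Finset.univ _ (Finset.mem_univ j)]
  have h1 : ∏ k ∈ Finset.univ.erase j, Φ.numeratorFactor ε (ν + Pi.single j 1) k
      = ∏ k ∈ Finset.univ.erase j, Φ.numeratorFactor ε ν k :=
    Finset.prod_congr rfl fun k hk => Φ.numeratorFactor_of_ne ε ν (Finset.ne_of_mem_erase hk)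
  have h2 : Φ.numeratorFactor ε (ν + Pi.single j 1) j = Φ.denom ε j ^ m := by
    have e1 : ¬ 0 < ν j + 1 := by omega
    have e2 : (-(ν j + 1)).toNat = m := by omega
    simp only [numeratorFactor, Pi.add_apply, Pi.single_eq_same, if_neg e1, e2]
  have h3 : Φ.numeratorFactor ε ν j = Φ.denom ε j ^ (m + 1) := by
    have e1 : ¬ 0 < ν j := by omega
    have e2 : (-(ν j)).toNat = m + 1 := by omega
    simp only [numeratorFactor, if_neg e1, e2]
  have h4 : (C (ν j : ℂ) : Scalar ι n) = -((m + 1 : ℕ) : Scalar ι n) := by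
    rw [hm]; push_cast; simp
  rw [h1, h2, h3, h4, dirDeriv_pow, Nat.add_sub_cancel]
  ring

theorem schwingerWeight_add_single_of_not {p : Fin P → Prop} [DecidablePred p] {j : Fin P}
    (hj : ¬ p j) (ν : Fin P → ℤ) (α : {j // p j} → ℝ) :
    schwingerWeight p (ν + Pi.single j 1) α = schwingerWeight p ν α := by
  refine Finset.prod_congr rfl fun k _ => ?_
  have : k.1 ≠ j := fun e => hj (e ▸ k.2)
  simp [Pi.single_eq_of_ne this]

/-- This is `Γ(ν + 1) = ν Γ(ν)`. -/
theorem schwingerWeight_add_single {p : Fin P → Prop} [DecidablePred p] {j : Fin P} (hj : p j)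
    {ν : Fin P → ℤ} (hν : ν j ≠ 0) {α : {j // p j} → ℝ} (hα : α ⟨j, hj⟩ ≠ 0) :
    schwingerWeight p (ν + Pi.single j 1) α
      = schwingerWeight p ν α * (Complex.I * α ⟨j, hj⟩ / ν j) := by
  have h : ∀ k : {j // p j}, Complex.I ^ (ν + Pi.single j 1 : Fin P → ℤ) k.1 *
      (α k : ℂ) ^ ((ν + Pi.single j 1 : Fin P → ℤ) k.1 - 1)
        / Complex.Gamma ((ν + Pi.single j 1 : Fin P → ℤ) k.1 : ℂ)
      = Complex.I ^ ν k.1 * (α k : ℂ) ^ (ν k.1 - 1) / Complex.Gamma (ν k.1 : ℂ)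
        * (if k = ⟨j, hj⟩ then Complex.I * α ⟨j, hj⟩ / ν j else 1) := by
    intro k
    by_cases e : k = ⟨j, hj⟩
    · subst e
      have h1 : (ν j : ℂ) ≠ 0 := Int.cast_ne_zero.mpr hν
      have h2 : (α ⟨j, hj⟩ : ℂ) ≠ 0 := Complex.ofReal_ne_zero.mpr hα
      simp only [Pi.add_apply, Pi.single_eq_same, if_true]
      rw [zpow_add_one₀ Complex.I_ne_zero, add_sub_right_comm, zpow_add_one₀ h2]
      push_cast
      rw [Complex.Gamma_add_one _ h1]
      simp only [div_eq_mul_inv, mul_inv]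
      ring
    · have e' : k.1 ≠ j := fun h => e (Subtype.ext h)
      simp [Pi.single_eq_of_ne e', e]
  simp only [schwingerWeight, h, Finset.prod_mul_distrib, Finset.prod_ite_eq', Finset.mem_univ,
    if_true]

/-- The contribution of the derivative of the `j`-th factor to the Gaussian integrand. -/
def factorDeriv (ε : ℝ) (ν : Fin P → ℤ) (i : ι) (v : Vec ι n) (N : Scalar ι n)
    (α : {j // 0 < ν j} → ℝ) (j : Fin P) : Scalar ι n :=
  N * ((∏ k ∈ Finset.univ.erase j, Φ.numeratorFactor ε ν k)
      * dirDeriv i v (Φ.numeratorFactor ε ν j))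
    - C (Complex.I * extendZero (fun j => 0 < ν j) α j) *
      (Φ.fullNumerator ε ν N * dirDeriv i v (Φ.denom ε j))

theorem dirDeriv_one (i : ι) (v : Vec ι n) : dirDeriv i v 1 = 0 := by
  simpa using dirDeriv_C i v 1

/-- Of the two parts of `factorDeriv` at most one is nonzero: if `ν j > 0` the numerator factor is 1
and has no derivative; otherwise the parameter is extended by zero. Thus one formula covers both
signs. -/
theorem schwingerOn_add_single (ε : ℝ) (D : ℂ) (ν : Fin P → ℤ) (i : ι) (v : Vec ι n)
    (N : Scalar ι n) {α : {j // 0 < ν j} → ℝ} (hα : ∀ j, 0 < α j) (j : Fin P) :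
    Φ.schwingerOn (fun j => 0 < ν j) ε D (ν + Pi.single j 1)
      (Φ.fullNumerator ε (ν + Pi.single j 1) (-(C (ν j : ℂ) * N * dirDeriv i v (Φ.denom ε j)))) α
      = Φ.schwingerOn (fun j => 0 < ν j) ε D ν (Φ.factorDeriv ε ν i v N α j) α := by
  rcases lt_trichotomy (ν j) 0 with h | h | h
  · have h' : ¬ 0 < ν j := by omega
    rw [schwingerOn, schwingerWeight_add_single_of_not (p := fun j => 0 < ν j) h',
      fullNumerator_add_single_of_neg Φ ε h, factorDeriv, extendZero, dif_neg h']
    simp [schwingerOn]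
  · have h' : ¬ 0 < ν j := by omega
    have e : Φ.numeratorFactor ε ν j = 1 := by simp [numeratorFactor, h]
    rw [factorDeriv, extendZero, dif_neg h', e, dirDeriv_one, h]
    simp [fullNumerator, schwingerOn_zero]
  · have e : Φ.numeratorFactor ε ν j = 1 := by simp [numeratorFactor, h]
    have h1 : (ν j : ℂ) ≠ 0 := Int.cast_ne_zero.mpr h.ne'
    rw [schwingerOn, schwingerWeight_add_single (p := fun j => 0 < ν j) h h.ne' (hα ⟨j, h⟩).ne',
      fullNumerator_add_single_of_pos Φ ε h, factorDeriv, extendZero, dif_pos h, e, dirDeriv_one,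
      schwingerOn]
    have e1 : Φ.fullNumerator ε ν (-(C (ν j : ℂ) * N * dirDeriv i v (Φ.denom ε j)))
        = C (-ν j : ℂ) * (Φ.fullNumerator ε ν N * dirDeriv i v (Φ.denom ε j)) := by
      simp only [fullNumerator, C_neg]; ring
    have e2 : N * ((∏ k ∈ Finset.univ.erase j, Φ.numeratorFactor ε ν k) * 0)
        - C (Complex.I * α ⟨j, h⟩) * (Φ.fullNumerator ε ν N * dirDeriv i v (Φ.denom ε j))
        = C (-(Complex.I * α ⟨j, h⟩)) *
          (Φ.fullNumerator ε ν N * dirDeriv i v (Φ.denom ε j)) := by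
      rw [C_neg]; ring
    rw [e1, e2, wickMean_C_mul, wickMean_C_mul]
    field_simp

theorem sum_factorDeriv (ε : ℝ) (D : ℂ) (ν : Fin P → ℤ) (i : ι) (v : Vec ι n)
    (N : Scalar ι n) (α : {j // 0 < ν j} → ℝ) :
    Φ.fullNumerator ε ν (divergence D i v * N + dirDeriv i v N)
      + ∑ j, Φ.factorDeriv ε ν i v N α j
    = divergence D i (Φ.fullNumerator ε ν N • v)
      - ∑ j, C (Complex.I * extendZero (fun j => 0 < ν j) α j) *
        dirDeriv i (Φ.fullNumerator ε ν N • v) (Φ.denom ε j) := by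
  simp only [factorDeriv, Finset.sum_sub_distrib, divergence_smul, smul_dirDeriv,
    ← Finset.mul_sum, ← dirDeriv_prod]
  simp only [fullNumerator_eq, dirDeriv_mul]
  ring

theorem schwingerOn_total_derivative (ε : ℝ) {D : ℂ} (hD : D ≠ 0) (ν : Fin P → ℤ) (i : ι)
    (v : Vec ι n) (N : Scalar ι n) {α : {j // 0 < ν j} → ℝ} (hα : ∀ j, 0 < α j) :
    Φ.schwingerOn (fun j => 0 < ν j) ε D ν
        (Φ.fullNumerator ε ν (divergence D i v * N + dirDeriv i v N)) α
      + ∑ j, Φ.schwingerOn (fun j => 0 < ν j) ε D (ν + Pi.single j 1)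
        (Φ.fullNumerator ε (ν + Pi.single j 1)
          (-(C (ν j : ℂ) * N * dirDeriv i v (Φ.denom ε j)))) α = 0 := by
  simp only [schwingerOn_add_single Φ ε D ν i v N hα]
  simp only [schwingerOn, ← Finset.mul_sum, ← mul_add, ← wickMean_sum, ← wickMean_add,
    sum_factorDeriv]
  -- Where `A` is singular, the Gaussian prefactor is `0 ^ (-D / 2) = 0`, which needs `D ≠ 0`.
  by_cases hdet : (Φ.quadMatrix (extendZero (fun j => 0 < ν j) α)).det = 0
  · have : Φ.gaussFactor ε D (extendZero (fun j => 0 < ν j) α) = 0 := by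
      rw [gaussFactor, hdet, Complex.ofReal_zero, Complex.zero_cpow (by simpa using hD)]
      simp
    rw [this]; simp
  · rw [Φ.wickMean_total_derivative ε D _ hdet]; simp

/-- The exponents of the terms of the total derivative. -/
def termExponent (ν : Fin P → ℤ) : Option (Fin P) → Fin P → ℤ
  | none => ν
  | some j => ν + Pi.single j 1

/-- The numerators of the terms of the total derivative. -/
def termNumerator (ε : ℝ) (D : ℂ) (i : ι) (v : Vec ι n) (N : Scalar ι n) (ν : Fin P → ℤ) :
    Option (Fin P) → Scalar ι n
  | none => divergence D i v * N + dirDeriv i v N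
  | some j => -(C (ν j : ℂ) * N * dirDeriv i v (Φ.denom ε j))

theorem termExponent_injective (ν : Fin P → ℤ) : Function.Injective (termExponent ν) := by
  rintro (_ | j) (_ | k) h
  · rfl
  · have := congrFun h k; simp [termExponent] at this
  · have := congrFun h j; simp [termExponent] at this
  · have := congrFun h j
    by_cases e : j = k
    · rw [e]
    · simp [termExponent, Pi.single_eq_of_ne e] at this

theorem totalDeriv_eq (ε : ℝ) (D : ℂ) (i : ι) (v : Vec ι n) (N : Scalar ι n) (ν : Fin P → ℤ) :
    Φ.totalDeriv ε D i v N ν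
      = ∑ o, Finsupp.single (termExponent ν o) (Φ.termNumerator ε D i v N ν o) := by
  rw [Fintype.sum_option]; rfl

theorem integrableOn_termNumerator {ε : ℝ} (hε : 0 < ε) (i : ι) (v : Vec ι n)
    {N : ℂ → Scalar ι n} (hN : UniformDegree N) (ν : Fin P → ℤ) (o : Option (Fin P)) :
    ∃ c : ℝ, ∀ D : ℂ, D.re ≤ c → IntegrableOn (Φ.schwinger ε D (termExponent ν o)
      (Φ.termNumerator ε D i v (N D) ν o)) {α | ∀ j, 0 < α j} := by
  -- The half-plane must not depend on `D`, although the numerator does; hence a degree bound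
  -- uniform in `D`.
  have h : UniformDegree fun D => Φ.termNumerator ε D i v (N D) ν o := by
    cases o with
    | none => exact ((UniformDegree.divergence i v).mul hN).add (hN.dirDeriv i v)
    | some j => exact (((UniformDegree.const _).mul hN).mul (UniformDegree.const _)).neg
  have h' : UniformDegree fun D => Φ.fullNumerator ε (termExponent ν o)
      (Φ.termNumerator ε D i v (N D) ν o) := h.mul (UniformDegree.const _)
  obtain ⟨d, hd⟩ := h'
  exact ⟨-(6 * d), fun D hD => Φ.integrableOn_schwinger hε _ d (hd D) hD⟩

theorem sum_integral_termNumerator {ε : ℝ} {D : ℂ} (hD : D ≠ 0) (i : ι) (v : Vec ι n)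
    (N : Scalar ι n) (ν : Fin P → ℤ)
    (hint : ∀ o, IntegrableOn (Φ.schwinger ε D (termExponent ν o)
      (Φ.termNumerator ε D i v N ν o)) {α | ∀ j, 0 < α j}) :
    ∑ o, ∫ α in {α | ∀ j, 0 < α j}, Φ.schwinger ε D (termExponent ν o)
      (Φ.termNumerator ε D i v N ν o) α = 0 := by
  have key : ∀ j, (∫ α in {α | ∀ j, 0 < α j}, Φ.schwinger ε D (termExponent ν (some j))
        (Φ.termNumerator ε D i v N ν (some j)) α)
      = (∫ α in {α | ∀ j, 0 < α j}, Φ.schwingerOn (fun j => 0 < ν j) ε D (ν + Pi.single j 1)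
        (Φ.fullNumerator ε (ν + Pi.single j 1)
          (-(C (ν j : ℂ) * N * dirDeriv i v (Φ.denom ε j)))) α) ∧
      IntegrableOn (Φ.schwingerOn (fun j => 0 < ν j) ε D (ν + Pi.single j 1)
        (Φ.fullNumerator ε (ν + Pi.single j 1)
          (-(C (ν j : ℂ) * N * dirDeriv i v (Φ.denom ε j))))) {α | ∀ j, 0 < α j} := by
    intro j
    -- Only from `ν j = 0` would the shift create a new parameter, and then the term carries the
    -- factor `ν j = 0`.
    by_cases h : ν j = 0
    · have e : -(C (ν j : ℂ) * N * dirDeriv i v (Φ.denom ε j)) = 0 := by simp [h]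
      simp only [termNumerator, e, schwinger_zero, fullNumerator, zero_mul, schwingerOn_zero]
      simp
      exact integrableOn_zero
    · have hpq : ∀ k, 0 < (ν + Pi.single j 1 : Fin P → ℤ) k ↔ 0 < ν k := by
        intro k
        by_cases e : k = j
        · subst e
          simp only [Pi.add_apply, Pi.single_eq_same]; omega
        · simp [Pi.single_eq_of_ne e]
      have hc := Φ.schwingerOn_congr hpq ε D (ν + Pi.single j 1)
        (Φ.fullNumerator ε (ν + Pi.single j 1)
          (-(C (ν j : ℂ) * N * dirDeriv i v (Φ.denom ε j))))
      exact ⟨hc.1, hc.2 (hint (some j))⟩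
  rw [Fintype.sum_option, Finset.sum_congr rfl fun j _ => (key j).1,
    ← integral_finsetSum _ fun j _ => (key j).2]
  have h0 : IntegrableOn (Φ.schwinger ε D ν (divergence D i v * N + dirDeriv i v N))
    {α | ∀ j, 0 < α j} := hint none
  change (∫ α in {α : {j // 0 < ν j} → ℝ | ∀ j, 0 < α j},
    Φ.schwinger ε D ν (divergence D i v * N + dirDeriv i v N) α) + _ = 0
  rw [← integral_add h0 (integrable_finsetSum _ fun j _ => (key j).2)]
  refine setIntegral_eq_zero_of_forall_eq_zero fun α hα => ?_
  exact Φ.schwingerOn_total_derivative ε hD ν i v N hα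

theorem exists_forall_totalDeriv {ε : ℝ} (hε : 0 < ε) (i : ι) (v : Vec ι n)
    {N : ℂ → Scalar ι n} (hN : UniformDegree N) (ν : Fin P → ℤ) :
    ∃ c : ℝ, ∀ D : ℂ, D.re < c →
      (∀ ν' ∈ (Φ.totalDeriv ε D i v (N D) ν).support, IntegrableOn
        (Φ.schwinger ε D ν' (Φ.totalDeriv ε D i v (N D) ν ν')) {α | ∀ j, 0 < α j}) ∧
      ((Φ.totalDeriv ε D i v (N D) ν).sum fun ν' N' =>
        ∫ α in {α | ∀ j, 0 < α j}, Φ.schwinger ε D ν' N' α) = 0 := by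
  choose c hc using Φ.integrableOn_termNumerator hε i v hN ν
  obtain ⟨c₀, hc₀⟩ := (Set.finite_range c).bddBelow
  -- The bound 0 excludes `D = 0`.
  refine ⟨min c₀ 0, fun D hD => ?_⟩
  have hint := fun o => hc o D ((hD.trans_le (min_le_left _ _)).le.trans (hc₀ ⟨o, rfl⟩))
  have hD0 : D ≠ 0 := by
    rintro rfl
    exact lt_irrefl _ (hD.trans_le (min_le_right _ _))
  simp only [totalDeriv_eq]
  constructor
  · intro ν' hν'
    obtain ⟨o, ho, hval⟩ := mem_support_sum_single (termExponent_injective ν) _ hν'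
    rw [hval, ho]
    exact hint o
  · rw [finsupp_sum_sum_single (termExponent_injective ν)]
    · exact Φ.sum_integral_termNumerator hD0 i v (N D) ν hint
    · intro ν'
      simp [schwinger_zero]

end Propagators

theorem FeynmanIntegrand.uniformDegree_numeratorAt {L E P n : ℕ} (F : FeynmanIntegrand L E P n)
    (S : Finset (Fin L)) (k : Fin L → Mink n) : UniformDegree (F.numeratorAt S k) := by
  unfold FeynmanIntegrand.numeratorAt
  generalize F.numerator = p
  induction p using MvPolynomial.induction_on with
  | C a => exact ⟨0, fun D => by simp [algebraMap_eq]⟩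
  | add p q hp hq =>
    simp only [map_add]
    exact hp.add hq
  | mul_X p x hp =>
    simp only [map_mul, map_X, aeval_X]
    exact hp.mul (UniformDegree.const _)

/-! ### Uniqueness of the continuation in `D`. -/

theorem meromorphicNFOn_zero : MeromorphicNFOn (0 : ℂ → ℂ) Set.univ :=
  fun _ _ => Or.inl (Filter.EventuallyEq.refl _ _)

/-- Infinite order at one point spreads over the connected plane, so `G` vanishes on a punctured
neighbourhood of every point; normal form then fixes the value at the point itself. -/
theorem eq_zero_of_meromorphicNFOn {G : ℂ → ℂ} (hG : MeromorphicNFOn G Set.univ) {c : ℝ}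
    (h : ∀ D : ℂ, D.re < c → G D = 0) : G = 0 := by
  have hev : ∀ᶠ z in nhds ((c - 1 : ℝ) : ℂ), G z = 0 := by
    have ho : IsOpen {z : ℂ | z.re < c} := isOpen_lt Complex.continuous_re continuous_const
    exact Filter.eventually_of_mem (ho.mem_nhds (by simp)) h
  have htop : meromorphicOrderAt G ((c - 1 : ℝ) : ℂ) = ⊤ :=
    meromorphicOrderAt_eq_top_iff.mpr (hev.filter_mono nhdsWithin_le_nhds)
  funext z
  have hz : meromorphicOrderAt G z = ⊤ := by
    by_contra hne
    exact hG.meromorphicOn.meromorphicOrderAt_ne_top_of_isPreconnected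
      isPreconnected_univ (Set.mem_univ z) (Set.mem_univ _) hne htop
  have h0 := (hG (Set.mem_univ z)).eventuallyEq_nhdsNE_iff_eventuallyEq_nhds
    (meromorphicNFOn_zero (Set.mem_univ z))
  exact (h0.mp (meromorphicOrderAt_eq_top_iff.mp hz)).self_of_nhds

end DimReg

end

/-- The dimensionally regulated integral of `∂/∂k_i^μ [v^μ F]` over the loop momenta in any set
`S` containing `i` (in particular `S = {i}`, or all of them) vanishes: the zero function is its
dimensionally regulated integral, and the only one. -/
theorem mainTheorem3 {L E P n : ℕ} (F : DimReg.FeynmanIntegrand L E P n)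
    (S : Finset (Fin L)) (i : Fin L) (hi : i ∈ S) (k : Fin L → DimReg.Mink n)
    (v : DimReg.Vec S n) (ε : ℝ) (hε : 0 < ε) (G : ℂ → ℂ) :
    (F.propagators S k).IsDimRegIntegral ε
      (fun D => (F.propagators S k).totalDeriv ε D ⟨i, hi⟩ v
        (F.numeratorAt S k D) F.exponent) G ↔ G = 0 := by
  obtain ⟨c, hc⟩ := (F.propagators S k).exists_forall_totalDeriv hε ⟨i, hi⟩ v
    (F.uniformDegree_numeratorAt S k) F.exponent
  constructor
  · rintro ⟨hG, c', hc'⟩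
    refine DimReg.eq_zero_of_meromorphicNFOn hG (c := min c c') fun D hD => ?_
    rw [(hc' D (hD.trans_le (min_le_right _ _))).2, (hc D (hD.trans_le (min_le_left _ _))).2]
  · rintro rfl
    exact ⟨DimReg.meromorphicNFOn_zero, c, fun D hD => ⟨(hc D hD).1, (hc D hD).2.symm⟩⟩
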